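/- Let $(V,g)$ be a spacetime: a connected, smooth, Hausdorff, second countable four-dimensional manifold with a smooth Lorentzian metric $g$ of signature $(-,+,+,+)$. Let $G_3$ be an Abelian three-parameter (local) group of isometries acting on timelike orbits $T_3$, given by its generators: a three-dimensional real vector space $\mathfrak g$ of pairwise commuting Killing vector fields such that for every $p\in V$ the tangent space $\mathfrak g|_p=\{\xi_p:\xi\in\mathfrak g\}$ of the orbit through $p$ contains a timelike vector, and $\dim \mathfrak g|_p=3$ for all $p$ outside a nowhere dense closed set. Let $G_2\subset G_3$ be a two-parameter subgroup acting on spacelike orbits $S_2$, given by a two-dimensional subspace $\mathfrak h\subset\mathfrak g$ such that for every $p$ the metric is positive definite on $\mathfrak h|_p$, and $\dim\mathfrak h|_p=2$ outside a nowhere dense closed set. (Thus the orbits may degenerate, for instance on an axis of symmetry.) Suppose that $G_2$ acts orthogonally transitively, that is, for all $\xi,\eta\in\mathfrak h$, with $\boldsymbol\xi=g(\xi,\cdot)$ and $\boldsymbol\eta=g(\eta,\cdot)$, $$\boldsymbol\xi\wedge\boldsymbol\eta\wedge d\boldsymbol\xi=0,\qquad \boldsymbol\xi\wedge\boldsymbol\eta\wedge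 d\boldsymbol\eta=0 .$$ Then there exists an integrable timelike Killing vector field on $V$, that is, a Killing vector field $s$ with $g(s,s)<0$ everywhere and $\boldsymbol s\wedge d\boldsymbol s=0$ (hypersurface-orthogonality), where $\boldsymbol s=g(s,\cdot)$. In other words, the spacetime is static. -/

import Mathlib

open scoped Manifold ContDiff Bundle

noncomputable section

namespace Spacetime

section

variable (M : Type*) [TopologicalSpace M] [ChartedSpace (EuclideanSpace ℝ (Fin 4)) M]

/-- A (not necessarily smooth) vector field on the four-dimensional manifold `M`. -/
abbrev VecField := (x : M) → TangentSpace (𝓡 4) x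

/-- A (not necessarily smooth) one-form on `M`. -/
abbrev OneForm := (x : M) → (TangentSpace (𝓡 4) x →L[ℝ] ℝ)

/-- A smooth Lorentzian metric on `M`, with signature `(-,+,+,+)`. -/
structure LorentzianMetric [IsManifold (𝓡 4) ∞ M] where
  /-- the metric as a bilinear form on each tangent space -/
  val (x : M) : TangentSpace (𝓡 4) x →L[ℝ] (TangentSpace (𝓡 4) x →L[ℝ] ℝ)
  symm (x : M) (u v : TangentSpace (𝓡 4) x) : val x u v = val x v u
  signature (x : M) : ∃ b : Module.Basis (Fin 4) ℝ (TangentSpace (𝓡 4) x),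
    ∀ i j, val x (b i) (b j) = if i = j then (if i = 0 then -1 else 1) else 0
  contMDiff : ContMDiff (𝓡 4)
    ((𝓡 4).prod 𝓘(ℝ, EuclideanSpace ℝ (Fin 4) →L[ℝ] EuclideanSpace ℝ (Fin 4) →L[ℝ] ℝ)) ∞
    (fun x ↦ Bundle.TotalSpace.mk'
      (EuclideanSpace ℝ (Fin 4) →L[ℝ] EuclideanSpace ℝ (Fin 4) →L[ℝ] ℝ) x (val x))

end

section

variable {M : Type*} [TopologicalSpace M] [ChartedSpace (EuclideanSpace ℝ (Fin 4)) M]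

/-- The vector field `X` is smooth at `x`. -/
def SmoothFieldAt [IsManifold (𝓡 4) ∞ M] (X : VecField M) (x : M) : Prop :=
  ContMDiffAt (𝓡 4) (𝓡 4).tangent ∞ (fun y ↦ (⟨y, X y⟩ : TangentBundle (𝓡 4) M)) x

/-- The derivative `v(f)` of a real function `f` in the direction of `v ∈ T_x M`. -/
def dirDeriv (f : M → ℝ) (x : M) (v : TangentSpace (𝓡 4) x) : ℝ :=
  mfderiv (𝓡 4) 𝓘(ℝ, ℝ) f x v

/-- The exterior derivative of a one-form, evaluated at `x` on two vector fields:
`dα(X, Y) = X(α(Y)) - Y(α(X)) - α([X, Y])`. -/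
def extDerivOneForm (α : OneForm M) (X Y : VecField M) (x : M) : ℝ :=
  dirDeriv (fun y ↦ α y (Y y)) x (X x) - dirDeriv (fun y ↦ α y (X y)) x (Y x)
    - α x (VectorField.mlieBracket (𝓡 4) X Y x)

/-- The three-form `α ∧ dβ`, evaluated at `x` on three vector fields. -/
def wedgeExtDeriv (α β : OneForm M) (X : Fin 3 → VecField M) (x : M) : ℝ :=
  (1 / 2 : ℝ) * ∑ σ : Equiv.Perm (Fin 3), ((Equiv.Perm.sign σ : ℤ) : ℝ) *
    (α x (X (σ 0) x) * extDerivOneForm β (X (σ 1)) (X (σ 2)) x)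

/-- The four-form `α ∧ β ∧ dγ`, evaluated at `x` on four vector fields. -/
def wedgeWedgeExtDeriv (α β γ : OneForm M) (X : Fin 4 → VecField M) (x : M) : ℝ :=
  (1 / 2 : ℝ) * ∑ σ : Equiv.Perm (Fin 4), ((Equiv.Perm.sign σ : ℤ) : ℝ) *
    (α x (X (σ 0) x) * β x (X (σ 1) x) * extDerivOneForm γ (X (σ 2)) (X (σ 3)) x)

/-- The tangent space at `x` to the orbit through `x` of the (local) transformation group whose
infinitesimal generators are the elements of `𝔨`. -/
def orbitTangent (𝔨 : Submodule ℝ (VecField M)) (x : M) :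
    Submodule ℝ (TangentSpace (𝓡 4) x) :=
  𝔨.map (LinearMap.proj x)

variable [IsManifold (𝓡 4) ∞ M] (g : LorentzianMetric M)

/-- The one-form `g(ξ, ·)` associated with a vector field. -/
def flat (ξ : VecField M) : OneForm M := fun x ↦ g.val x (ξ x)

/-- `ξ` is a Killing vector field: it is smooth and the Lie derivative of the metric along `ξ`
vanishes, i.e. `ξ(g(X, Y)) = g([ξ, X], Y) + g(X, [ξ, Y])` for all vector fields `X`, `Y`. -/
def IsKilling (ξ : VecField M) : Prop :=
  (∀ x, SmoothFieldAt ξ x) ∧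
  ∀ (x : M) (X Y : VecField M), SmoothFieldAt X x → SmoothFieldAt Y x →
    dirDeriv (fun y ↦ g.val y (X y) (Y y)) x (ξ x)
      = g.val x (VectorField.mlieBracket (𝓡 4) ξ X x) (Y x)
        + g.val x (X x) (VectorField.mlieBracket (𝓡 4) ξ Y x)

/-- `ξ` is timelike at every point. -/
def IsTimelike (ξ : VecField M) : Prop :=
  ∀ x, g.val x (ξ x) (ξ x) < 0

/-- `ξ` is integrable, i.e. hypersurface-orthogonal: `ξ ∧ dξ = 0`. -/
def IsIntegrable (ξ : VecField M) : Prop :=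
  ∀ (x : M) (X : Fin 3 → VecField M), (∀ i, SmoothFieldAt (X i) x) →
    wedgeExtDeriv (flat g ξ) (flat g ξ) X x = 0

/-- `𝔨` is the space of infinitesimal generators of an Abelian `r`-parameter (local) group of
isometries: an `r`-dimensional space of pairwise commuting Killing vector fields. -/
structure IsAbelianIsometryGroup (r : ℕ) (𝔨 : Submodule ℝ (VecField M)) : Prop where
  finite : Module.Finite ℝ 𝔨
  finrank_eq : Module.finrank ℝ 𝔨 = r
  killing : ∀ ξ ∈ 𝔨, IsKilling g ξ
  commute : ∀ ξ ∈ 𝔨, ∀ η ∈ 𝔨, ∀ x, VectorField.mlieBracket (𝓡 4) ξ η x = 0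

/-- The group acts on timelike orbits `T_d`: every orbit is timelike, and the orbits have dimension
`d` except for those through the points of a nowhere dense set (such as an axis of symmetry), where
the dimension may drop. -/
structure ActsOnTimelike (d : ℕ) (𝔨 : Submodule ℝ (VecField M)) : Prop where
  timelike : ∀ x, ∃ v ∈ orbitTangent 𝔨 x, g.val x v v < 0
  dense : Dense {x | Module.finrank ℝ (orbitTangent 𝔨 x) = d}

/-- The group acts on spacelike orbits `S_d`: every orbit is spacelike, and the orbits have
dimension `d` except for those through the points of a nowhere dense set (such as an axis of
symmetry), where the dimension may drop. -/
structure ActsOnSpacelike (d : ℕ) (𝔨 : Submodule ℝ (VecField M)) : Prop where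
  spacelike : ∀ x, ∀ v ∈ orbitTangent 𝔨 x, v ≠ 0 → 0 < g.val x v v
  dense : Dense {x | Module.finrank ℝ (orbitTangent 𝔨 x) = d}

/-- A two-parameter group acts orthogonally transitively: for all generators `ξ`, `η` one has
`ξ ∧ η ∧ dξ = 0` and `ξ ∧ η ∧ dη = 0`. This says that the planes orthogonal to the orbits
are tangent to surfaces. -/
def ActsOrthogonallyTransitively (𝔥 : Submodule ℝ (VecField M)) : Prop :=
  ∀ ξ ∈ 𝔥, ∀ η ∈ 𝔥, ∀ (x : M) (X : Fin 4 → VecField M), (∀ i, SmoothFieldAt (X i) x) →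
    wedgeWedgeExtDeriv (flat g ξ) (flat g η) (flat g ξ) X x = 0 ∧
    wedgeWedgeExtDeriv (flat g ξ) (flat g η) (flat g η) X x = 0

/-- A spacetime is static if it admits an integrable timelike Killing vector field. -/
def IsStatic : Prop :=
  ∃ s : VecField M, IsKilling g s ∧ IsTimelike g s ∧ IsIntegrable g s

end

end Spacetime

end

/-!
Let `ξ, η` span `𝔥` and let `σ ∈ 𝔤` lie outside of `𝔥`. The static Killing field is the element
`s = σ + k₁ ξ + k₂ η` of `𝔤` that is orthogonal to the orbits of `𝔥`; the point is that the
coefficients `k₁`, `k₂`, which this condition determines at every point with a two-dimensional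
orbit of `𝔥`, are constant.

At such a point `q`, freeze the coefficients, so that `s` is a Killing field with `s_q ⊥ 𝔥|_q`.
All fields of `𝔤` commute, hence the contraction of `dξ` (of the one-form `g(ξ, ·)`) with `s` is
`-d(g(ξ, s))`, and `dξ` vanishes on pairs of elements of `𝔤`. Evaluating `ξ ∧ η ∧ dξ = 0` and
`ξ ∧ η ∧ dη = 0` on `ξ, η, s` and an arbitrary fourth vector therefore leaves the Gram determinant
of `ξ, η` times `d(g(ξ, s))`, respectively `d(g(η, s))`, and both differentials vanish at `q`
(`dirDeriv_metricProd_eq_zero_of_orthogonal`). Differentiating the linear equations that define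
`k₁, k₂` gives `dk₁ = dk₂ = 0`, so the coefficients are constant on connected sets of points with
nondegenerate orbits (`exists_const_of_fderiv_relation`, `exists_orthogonal_on_preconnected`).

The points with degenerate orbits do not disconnect the manifold locally. Let `ξ ≠ 0` vanish at
`p`. Its linearization `L` at `p` is skew for the metric, and nonzero, since a Killing field with
vanishing first jet vanishes on an open set (`eventually_eq_zero_of_killing`), where the action
could not be free; hence `L` has rank at least two (`one_lt_finrank_range_of_skew`). If another
independent generator `η` vanished at `p`, the two linearizations would be commuting skew maps
annihilating a timelike vector, the value at `p` of an element of `𝔤`; as `so(3)` has rank one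
they would be dependent, and a nonzero generator would have a vanishing first jet
(`exists_smul_add_smul_eq_zero_of_commute_of_skew`, `ne_zero_of_eq_zero`). So `η_p ≠ 0`, and near
`p` the degenerate orbits are the zeros of the component of `ξ` orthogonal to `η`. The derivative
of this component at `p` is again `L`, so the degenerate orbits lie in a submanifold of
codimension at least two, the complement of which is connected and dense near `p`
(`exists_isOpen_preconnected_ne_zero`, `exists_isOpen_preconnected_gram_ne_zero`). By continuity
some `s ∈ σ + 𝔥` is orthogonal to `𝔥` in a full neighbourhood of any given point, and since `M` is
connected the same `s` serves everywhere (`exists_orthogonal`).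

Finally `s` is timelike because the orbits of `𝔤` are timelike and those of `𝔥` spacelike
(`isTimelike_of_orthogonal`). Both the one-form `g(s, ·)` and, by the formula for contractions
above, its exterior derivative are annihilated by `𝔥`; where `𝔥` acts freely the three-form
`s ∧ ds` thus comes from a two-dimensional quotient and vanishes, and it vanishes everywhere by
density (`isIntegrable_of_orthogonal`).
-/

namespace Spacetime

/-! ### Lorentzian linear algebra -/

section LinearAlgebra

/-- In an orthonormal frame `b` of signature `(-,+,+,+)` a bilinear form is
`-u₀v₀ + u₁v₁ + u₂v₂ + u₃v₃`. -/
theorem lorentz_apply {V : Type*} [TopologicalSpace V] [AddCommGroup V] [Module ℝ V]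
    (B : V →L[ℝ] V →L[ℝ] ℝ) (b : Module.Basis (Fin 4) ℝ V)
    (hb : ∀ i j, B (b i) (b j) = if i = j then (if i = 0 then -1 else 1) else 0) (u v : V) :
    B u v = -(b.repr u 0 * b.repr v 0) + b.repr u 1 * b.repr v 1 + b.repr u 2 * b.repr v 2
      + b.repr u 3 * b.repr v 3 := by
  conv_lhs => rw [← b.sum_repr u, ← b.sum_repr v]
  simp only [map_sum, map_smul, FunLike.coe_sum, Finset.sum_apply, FunLike.coe_smul,
    Pi.smul_apply, hb, smul_eq_mul]
  simp [Fin.sum_univ_four]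
  ring

/-- The orthogonal complement of a timelike vector is positive definite. -/
theorem pos_of_orthogonal_timelike {V : Type*} [TopologicalSpace V] [AddCommGroup V] [Module ℝ V]
    (B : V →L[ℝ] V →L[ℝ] ℝ) (b : Module.Basis (Fin 4) ℝ V)
    (hb : ∀ i j, B (b i) (b j) = if i = j then (if i = 0 then -1 else 1) else 0)
    {t w : V} (ht : B t t < 0) (htw : B t w = 0) (hw : w ≠ 0) : 0 < B w w := by
  rw [lorentz_apply B b hb] at ht htw ⊢
  have hne : ¬ (b.repr w 0 = 0 ∧ b.repr w 1 = 0 ∧ b.repr w 2 = 0 ∧ b.repr w 3 = 0) := by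
    rintro ⟨h0, h1, h2, h3⟩
    apply hw
    rw [← b.sum_repr w, Fin.sum_univ_four, h0, h1, h2, h3]
    simp
  generalize b.repr t 0 = t0 at *
  generalize b.repr t 1 = t1 at *
  generalize b.repr t 2 = t2 at *
  generalize b.repr t 3 = t3 at *
  generalize b.repr w 0 = s at *
  generalize b.repr w 1 = y1 at *
  generalize b.repr w 2 = y2 at *
  generalize b.repr w 3 = y3 at *
  by_contra hcon
  -- the Cauchy-Schwarz inequality for the spatial components
  have hcs : (t0 * s) ^ 2 ≤ (t1 ^ 2 + t2 ^ 2 + t3 ^ 2) * (y1 ^ 2 + y2 ^ 2 + y3 ^ 2) := by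
    have : t0 * s = t1 * y1 + t2 * y2 + t3 * y3 := by linarith
    rw [this]
    nlinarith [sq_nonneg (t1 * y2 - t2 * y1), sq_nonneg (t1 * y3 - t3 * y1),
      sq_nonneg (t2 * y3 - t3 * y2)]
  have hy : y1 ^ 2 + y2 ^ 2 + y3 ^ 2 ≤ s ^ 2 := by nlinarith
  have ht' : 0 < t0 ^ 2 - (t1 ^ 2 + t2 ^ 2 + t3 ^ 2) := by nlinarith
  have h1 : (t1 ^ 2 + t2 ^ 2 + t3 ^ 2) * (y1 ^ 2 + y2 ^ 2 + y3 ^ 2)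
      ≤ (t1 ^ 2 + t2 ^ 2 + t3 ^ 2) * s ^ 2 :=
    mul_le_mul_of_nonneg_left hy (by positivity)
  have hs : s = 0 := by
    by_contra hs
    have : 0 < (t0 ^ 2 - (t1 ^ 2 + t2 ^ 2 + t3 ^ 2)) * s ^ 2 := by positivity
    nlinarith
  subst hs
  refine hne ⟨rfl, ?_, ?_, ?_⟩ <;> nlinarith [sq_nonneg y1, sq_nonneg y2, sq_nonneg y3]

theorem lorentz_nondegenerate {V : Type*} [TopologicalSpace V] [AddCommGroup V] [Module ℝ V]
    (B : V →L[ℝ] V →L[ℝ] ℝ) (b : Module.Basis (Fin 4) ℝ V)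
    (hb : ∀ i j, B (b i) (b j) = if i = j then (if i = 0 then -1 else 1) else 0)
    {u : V} (hu : ∀ v, B u v = 0) : u = 0 := by
  have h (i : Fin 4) : b.repr u i = 0 := by
    have := hu (b i)
    rw [lorentz_apply B b hb] at this
    fin_cases i <;> simpa [Finsupp.single_apply] using this
  rw [← b.sum_repr u]
  simp [h]

variable {E : Type*} [NormedAddCommGroup E] [NormedSpace ℝ E]

/-- A nonzero endomorphism that is skew for a nondegenerate symmetric form has rank at least two:
if its range were spanned by `w`, then `w` would be orthogonal to everything. -/
theorem one_lt_finrank_range_of_skew [FiniteDimensional ℝ E] (B : E →L[ℝ] E →L[ℝ] ℝ)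
    (hsymm : ∀ u v, B u v = B v u) (hnd : ∀ u, (∀ v, B u v = 0) → u = 0) (L : E →L[ℝ] E)
    (hskew : ∀ u v, B (L u) v + B u (L v) = 0) (hL : L ≠ 0) :
    1 < Module.finrank ℝ L.range := by
  by_contra hcon
  -- `L` takes its values in the multiples of `w`
  obtain ⟨w, hw⟩ := finrank_le_one_iff.mp (not_lt.mp hcon)
  obtain ⟨u₀, hu₀⟩ : ∃ u, L u ≠ 0 := by
    by_contra! h
    exact hL (ContinuousLinearMap.ext h)
  have hrep (u : E) : ∃ c : ℝ, c • (w : E) = L u := by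
    obtain ⟨c, hc⟩ := hw ⟨L u, u, rfl⟩
    exact ⟨c, congrArg Subtype.val hc⟩
  obtain ⟨c₀, hc₀⟩ := hrep u₀
  have hc₀' : c₀ ≠ 0 := by
    rintro rfl
    exact hu₀ (by rw [← hc₀, zero_smul])
  have hw0 : (w : E) = 0 := by
    apply hnd
    intro v
    obtain ⟨c, hc⟩ := hrep v
    have h1 := hskew v v
    rw [hsymm v (L v), ← hc] at h1
    have h2 := hskew u₀ v
    rw [← hc, ← hc₀] at h2
    simp only [map_smul, FunLike.coe_smul, Pi.smul_apply, smul_eq_mul] at h1 h2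
    rcases eq_or_ne c 0 with rfl | hne
    · simpa [hc₀'] using h2
    · have : c * B w v = 0 := by linarith
      simpa [hne] using this
  exact hu₀ (by rw [← hc₀, hw0, smul_zero])

/-- Two commuting endomorphisms of a four-dimensional Lorentzian vector space which are skew and
annihilate a common timelike vector are linearly dependent: `so(3)` has rank one. -/
theorem exists_smul_add_smul_eq_zero_of_commute_of_skew (hdim : Module.finrank ℝ E = 4)
    (B : E →L[ℝ] E →L[ℝ] ℝ) (hsymm : ∀ u v, B u v = B v u)
    (t : E) (ht : B t t < 0) (hpos : ∀ w, B t w = 0 → w ≠ 0 → 0 < B w w)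
    (L₁ L₂ : E →L[ℝ] E)
    (hs₁ : ∀ u v, B (L₁ u) v + B u (L₁ v) = 0) (hs₂ : ∀ u v, B (L₂ u) v + B u (L₂ v) = 0)
    (ht₁ : L₁ t = 0) (ht₂ : L₂ t = 0) (hcomm : ∀ v, L₁ (L₂ v) = L₂ (L₁ v)) :
    ∃ x y : ℝ, (x ≠ 0 ∨ y ≠ 0) ∧ x • L₁ + y • L₂ = 0 := by
  have hfd : FiniteDimensional ℝ E := .of_finrank_pos (by omega)
  have hBt : (B t : E →ₗ[ℝ] ℝ) ≠ 0 := by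
    intro h
    have : B t t = 0 := LinearMap.congr_fun h t
    linarith
  have hker : Module.finrank ℝ (LinearMap.ker (B t : E →ₗ[ℝ] ℝ)) = 3 := by
    have := Module.Dual.finrank_ker_add_one_of_ne_zero (f := (B t : E →ₗ[ℝ] ℝ)) hBt
    omega
  let e := Module.finBasisOfFinrankEq ℝ _ hker
  obtain ⟨e₁, he₁⟩ : ∃ x : E, x = e 0 := ⟨_, rfl⟩
  obtain ⟨e₂, he₂⟩ : ∃ x : E, x = e 1 := ⟨_, rfl⟩
  obtain ⟨e₃, he₃⟩ : ∃ x : E, x = e 2 := ⟨_, rfl⟩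
  have hW (w : E) (hw : B t w = 0) : ∃ a b c : ℝ, w = a • e₁ + b • e₂ + c • e₃ := by
    have h := e.sum_repr ⟨w, hw⟩
    rw [Fin.sum_univ_three] at h
    exact ⟨_, _, _, by rw [he₁, he₂, he₃]; exact (congrArg Subtype.val h).symm⟩
  have hexp (v : E) : ∃ d a b c : ℝ, v = d • t + (a • e₁ + b • e₂ + c • e₃) := by
    obtain ⟨a, b, c, h⟩ := hW (v - (B t v / B t t) • t) (by
      simp only [map_sub, map_smul, smul_eq_mul]; rw [div_mul_cancel₀ _ ht.ne, sub_self])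
    exact ⟨B t v / B t t, a, b, c, by rw [← h]; abel⟩
  have hind (a b c : ℝ) (h : a • e₁ + b • e₂ + c • e₃ = 0) : a = 0 ∧ b = 0 ∧ c = 0 := by
    have hli := Fintype.linearIndependent_iff.mp e.linearIndependent ![a, b, c] (by
      apply Subtype.ext
      rw [Fin.sum_univ_three]
      simpa [he₁, he₂, he₃] using h)
    exact ⟨hli 0, hli 1, hli 2⟩
  have hnd (u : E) (hu : ∀ v, B u v = 0) : u = 0 := by
    by_contra hne
    have := hpos u (by rw [hsymm]; exact hu t) hne
    rw [hu u] at this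
    exact lt_irrefl _ this
  have hdiag (L : E →L[ℝ] E) (hs : ∀ u v, B (L u) v + B u (L v) = 0) (u : E) :
      B (L u) u = 0 := by
    have := hs u u
    rw [hsymm u] at this
    linarith
  have hanti (L : E →L[ℝ] E) (hs : ∀ u v, B (L u) v + B u (L v) = 0) (u v : E) :
      B (L u) v = - B (L v) u := by
    have := hs u v
    rw [hsymm u] at this
    linarith
  have hLt (L : E →L[ℝ] E) (hs : ∀ u v, B (L u) v + B u (L v) = 0) (h : L t = 0) (u : E) :
      B (L u) t = 0 := by
    rw [hanti L hs, h]; simp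
  -- a skew endomorphism annihilating `t` is determined by the values of its two-form on the
  -- pairs of basis vectors of the orthogonal complement
  have hzero (L : E →L[ℝ] E) (hs : ∀ u v, B (L u) v + B u (L v) = 0) (h : L t = 0) (u : E)
      (h1 : B (L u) e₁ = 0) (h2 : B (L u) e₂ = 0) (h3 : B (L u) e₃ = 0) : L u = 0 := by
    apply hnd
    intro v
    obtain ⟨d, a, b, c, rfl⟩ := hexp v
    simp [hLt L hs h, h1, h2, h3]
  have hLzero (L : E →L[ℝ] E) (hs : ∀ u v, B (L u) v + B u (L v) = 0) (h : L t = 0)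
      (h1 : B (L e₂) e₃ = 0) (h2 : B (L e₃) e₁ = 0) (h3 : B (L e₁) e₂ = 0) : L = 0 := by
    have k1 : L e₁ = 0 := hzero L hs h _ (hdiag L hs _) h3 (by rw [hanti L hs, h2, neg_zero])
    have k2 : L e₂ = 0 := hzero L hs h _ (by rw [hanti L hs, h3, neg_zero]) (hdiag L hs _) h1
    have k3 : L e₃ = 0 := hzero L hs h _ h2 (by rw [hanti L hs, h1, neg_zero]) (hdiag L hs _)
    ext v
    obtain ⟨d, a, b, c, rfl⟩ := hexp v
    simp [h, k1, k2, k3]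
  set p₁ := B (L₁ e₂) e₃ with hp₁
  set q₁ := B (L₁ e₃) e₁ with hq₁
  set r₁ := B (L₁ e₁) e₂ with hr₁
  set p₂ := B (L₂ e₂) e₃ with hp₂
  set q₂ := B (L₂ e₃) e₁ with hq₂
  set r₂ := B (L₂ e₁) e₂ with hr₂
  by_cases hall : p₁ = 0 ∧ q₁ = 0 ∧ r₁ = 0
  · exact ⟨1, 0, Or.inl one_ne_zero, by simp [hLzero L₁ hs₁ ht₁ hall.1 hall.2.1 hall.2.2]⟩
  have val (L : E →L[ℝ] E) (hs : ∀ u v, B (L u) v + B u (L v) = 0) (a b c : ℝ) :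
      B (L (a • e₁ + b • e₂ + c • e₃)) e₁ = c * B (L e₃) e₁ - b * B (L e₁) e₂ ∧
      B (L (a • e₁ + b • e₂ + c • e₃)) e₂ = a * B (L e₁) e₂ - c * B (L e₂) e₃ ∧
      B (L (a • e₁ + b • e₂ + c • e₃)) e₃ = b * B (L e₂) e₃ - a * B (L e₃) e₁ := by
    simp only [map_add, map_smul, FunLike.coe_add, FunLike.coe_smul,
      Pi.add_apply, Pi.smul_apply, smul_eq_mul, hdiag L hs]
    rw [hanti L hs e₂ e₁, hanti L hs e₃ e₂, hanti L hs e₁ e₃]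
    refine ⟨by ring, by ring, by ring⟩
  -- the axis of the infinitesimal rotation `L₁`
  set n : E := p₁ • e₁ + q₁ • e₂ + r₁ • e₃ with hn
  obtain ⟨v1, v2, v3⟩ := val L₁ hs₁ p₁ q₁ r₁
  have hL₁n : L₁ n = 0 := by
    apply hzero L₁ hs₁ ht₁
    · rw [hn, v1]; ring
    · rw [hn, v2]; ring
    · rw [hn, v3]; ring
  have hL₂n : L₂ n = 0 := by
    obtain ⟨a, b, c, hm⟩ := hW (L₂ n) (by rw [hsymm]; exact hLt L₂ hs₂ ht₂ n)
    have h0 : L₁ (a • e₁ + b • e₂ + c • e₃) = 0 := by rw [← hm, hcomm, hL₁n, map_zero]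
    obtain ⟨w1, w2, w3⟩ := val L₁ hs₁ a b c
    rw [h0] at w1 w2 w3
    simp only [map_zero, FunLike.coe_zero, Pi.zero_apply, ← hp₁, ← hq₁, ← hr₁] at w1 w2 w3
    -- `L₂ n` is proportional to `n` and orthogonal to it
    have key : B (L₂ n) (L₂ n) = 0 := by
      have hd := hdiag L₂ hs₂ n
      rw [not_and_or, not_and_or] at hall
      rcases hall with h | h | h
      · have : p₁ • L₂ n = a • n := by
          rw [hm, hn]; simp only [smul_add, smul_smul]
          rw [show p₁ * b = a * q₁ by linarith, show p₁ * c = a * r₁ by linarith, mul_comm p₁ a]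
        have h' : p₁ * B (L₂ n) (L₂ n) = 0 := by
          rw [← smul_eq_mul, ← map_smul, this, map_smul, hd, smul_zero]
        simpa [h] using h'
      · have : q₁ • L₂ n = b • n := by
          rw [hm, hn]; simp only [smul_add, smul_smul]
          rw [show q₁ * a = b * p₁ by linarith, show q₁ * c = b * r₁ by linarith, mul_comm q₁ b]
        have h' : q₁ * B (L₂ n) (L₂ n) = 0 := by
          rw [← smul_eq_mul, ← map_smul, this, map_smul, hd, smul_zero]
        simpa [h] using h'
      · have : r₁ • L₂ n = c • n := by
          rw [hm, hn]; simp only [smul_add, smul_smul]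
          rw [show r₁ * a = c * p₁ by linarith, show r₁ * b = c * q₁ by linarith, mul_comm r₁ c]
        have h' : r₁ * B (L₂ n) (L₂ n) = 0 := by
          rw [← smul_eq_mul, ← map_smul, this, map_smul, hd, smul_zero]
        simpa [h] using h'
    by_contra hne
    exact absurd key (hpos _ (by rw [hsymm]; exact hLt L₂ hs₂ ht₂ n) hne).ne'
  obtain ⟨w1, w2, w3⟩ := val L₂ hs₂ p₁ q₁ r₁
  rw [← hn, hL₂n] at w1 w2 w3
  simp only [map_zero, FunLike.coe_zero, Pi.zero_apply, ← hp₂, ← hq₂, ← hr₂] at w1 w2 w3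
  have hcomb (x y : ℝ) : x • L₁ + y • L₂ = 0 ↔
      x * p₁ + y * p₂ = 0 ∧ x * q₁ + y * q₂ = 0 ∧ x * r₁ + y * r₂ = 0 := by
    constructor
    · intro h
      have h' (u v : E) : x * B (L₁ u) v + y * B (L₂ u) v = 0 := by
        have := congrArg (fun L : E →L[ℝ] E => B (L u) v) h
        simpa using this
      exact ⟨h' _ _, h' _ _, h' _ _⟩
    · rintro ⟨h1, h2, h3⟩
      apply hLzero
      · intro u v
        have k1 := hs₁ u v
        have k2 := hs₂ u v
        simp only [FunLike.coe_add, FunLike.coe_smul, Pi.add_apply,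
          Pi.smul_apply, map_add, map_smul, smul_eq_mul]
        linear_combination x * k1 + y * k2
      · simp [ht₁, ht₂]
      · simpa using h1
      · simpa using h2
      · simpa using h3
  rw [not_and_or, not_and_or] at hall
  rcases hall with h | h | h
  · exact ⟨p₂, -p₁, Or.inr (neg_ne_zero.mpr h), (hcomb _ _).mpr
      ⟨by ring, by linarith, by linarith⟩⟩
  · exact ⟨q₂, -q₁, Or.inr (neg_ne_zero.mpr h), (hcomb _ _).mpr
      ⟨by linarith, by ring, by linarith⟩⟩
  · exact ⟨r₂, -r₁, Or.inr (neg_ne_zero.mpr h), (hcomb _ _).mpr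
      ⟨by linarith, by linarith, by ring⟩⟩

/-- On a four-dimensional space the three-form `α ∧ θ` vanishes as soon as two independent vectors
`x`, `y` are annihilated by both `α` and `θ`, since it descends to the two-dimensional quotient. -/
theorem wedge_eq_zero_of_two_kernel_vectors (hdim : Module.finrank ℝ E = 4)
    (α : E →L[ℝ] ℝ) (θ : E → E → ℝ)
    (hadd : ∀ u v w, θ (u + v) w = θ u w + θ v w) (hsmul : ∀ (c : ℝ) u w, θ (c • u) w = c * θ u w)
    (hanti : ∀ u v, θ u v = - θ v u) {x y : E} (hxy : LinearIndependent ℝ ![x, y])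
    (hαx : α x = 0) (hαy : α y = 0) (hθx : ∀ v, θ x v = 0) (hθy : ∀ v, θ y v = 0)
    (u v w : E) : α u * θ v w + α v * θ w u + α w * θ u v = 0 := by
  have hfd : FiniteDimensional ℝ E := .of_finrank_pos (by omega)
  -- five vectors of a four-dimensional space are linearly dependent
  obtain ⟨c, hc, hc0⟩ : ∃ c : Fin 5 → ℝ, ∑ i, c i • ![u, v, w, x, y] i = 0 ∧ ∃ i, c i ≠ 0 := by
    have : ¬ LinearIndependent ℝ ![u, v, w, x, y] := by
      intro h
      have := h.fintype_card_le_finrank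
      simp [hdim] at this
    simpa using Fintype.not_linearIndependent_iff.mp this
  simp only [Fin.sum_univ_five] at hc
  replace hc : c 0 • u + c 1 • v + c 2 • w + c 3 • x + c 4 • y = 0 := hc
  have hα : c 0 * α u + c 1 * α v + c 2 * α w = 0 := by
    have := congrArg α hc
    simpa [hαx, hαy] using this
  have hθ (z : E) : c 0 * θ u z + c 1 * θ v z + c 2 * θ w z = 0 := by
    have h0 : θ 0 z = 0 := by simpa using hsmul 0 0 z
    have := congrArg (fun a => θ a z) hc
    simpa [hadd, hsmul, hθx, hθy, h0] using this
  have hu := hθ u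
  have hv := hθ v
  have hw := hθ w
  have huu : θ u u = 0 := by linarith [hanti u u]
  have hvv : θ v v = 0 := by linarith [hanti v v]
  have hww : θ w w = 0 := by linarith [hanti w w]
  rw [huu, hanti v u] at hu
  rw [hvv, hanti w v] at hv
  rw [hww, hanti u w] at hw
  by_cases h0 : c 0 = 0
  · by_cases h1 : c 1 = 0
    · by_cases h2 : c 2 = 0
      · have h34 : c 3 • x + c 4 • y = 0 := by simpa [h0, h1, h2] using hc
        obtain ⟨h3, h4⟩ := LinearIndependent.pair_iff.mp hxy _ _ h34
        obtain ⟨i, hi⟩ := hc0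
        fin_cases i <;> exact absurd (by assumption) hi
      · apply (mul_eq_zero.mp (?_ : c 2 * _ = 0)).resolve_left h2
        linear_combination θ u v * hα - α u * hv + α v * hu
    · apply (mul_eq_zero.mp (?_ : c 1 * _ = 0)).resolve_left h1
      linear_combination θ w u * hα + α u * hw - α w * hu
  · apply (mul_eq_zero.mp (?_ : c 0 * _ = 0)).resolve_left h0
    linear_combination θ v w * hα - α v * hw + α w * hv

theorem exists_pair_of_finrank_eq_two {V : Type*} [AddCommGroup V] [Module ℝ V]
    {W : Submodule ℝ V} (hW : Module.finrank ℝ W = 2) {ξ : V} (hξ : ξ ∈ W) (hξ0 : ξ ≠ 0) :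
    ∃ η ∈ W, (∀ a b : ℝ, a • ξ + b • η = 0 → a = 0 ∧ b = 0) ∧
      ∀ ζ ∈ W, ∃ a b : ℝ, ζ = a • ξ + b • η := by
  obtain ⟨η, hη⟩ := exists_linearIndependent_pair_of_one_lt_finrank (R := ℝ) (M := W)
    (by omega) (x := ⟨ξ, hξ⟩) (by simpa using hξ0)
  have hspan := hη.span_eq_top_of_card_eq_finrank (by simp [hW])
  refine ⟨η, η.2, fun a b h ↦ ?_, fun ζ hζ ↦ ?_⟩
  · exact LinearIndependent.pair_iff.mp hη a b (Subtype.ext h)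
  · have : (⟨ζ, hζ⟩ : W) ∈ Submodule.span ℝ (Set.range ![⟨ξ, hξ⟩, η]) := hspan ▸ Submodule.mem_top
    rw [Matrix.range_cons, Matrix.range_cons, Matrix.range_empty, Set.union_empty,
      Set.singleton_union, Submodule.mem_span_pair] at this
    obtain ⟨a, b, h⟩ := this
    exact ⟨a, b, (congrArg Subtype.val h).symm⟩

theorem exists_sub_smul_mem {V : Type*} [AddCommGroup V] [Module ℝ V] {U W : Submodule ℝ V}
    [Module.Finite ℝ U] (hle : W ≤ U) (hd : Module.finrank ℝ U = Module.finrank ℝ W + 1) {s : V}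
    (hs : s ∈ U) (hsW : s ∉ W) {t : V} (ht : t ∈ U) : ∃ c : ℝ, t - c • s ∈ W := by
  have hsup : W ⊔ ℝ ∙ s ≤ U := sup_le hle (by simpa using hs)
  have hfin : Module.Finite ℝ (W ⊔ ℝ ∙ s : Submodule ℝ V) := Submodule.finiteDimensional_of_le hsup
  have hlt : Module.finrank ℝ W < Module.finrank ℝ (W ⊔ ℝ ∙ s : Submodule ℝ V) := by
    apply Submodule.finrank_lt_finrank_of_lt
    refine lt_of_le_of_ne le_sup_left fun h ↦ hsW ?_
    rw [h]
    exact Submodule.mem_sup_right (Submodule.mem_span_singleton_self s)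
  have heq := Submodule.eq_of_le_of_finrank_le hsup (by omega)
  rw [← heq] at ht
  obtain ⟨w, hw, z, hz, rfl⟩ := Submodule.mem_sup.mp ht
  obtain ⟨c, rfl⟩ := Submodule.mem_span_singleton.mp hz
  exact ⟨c, by simpa using hw⟩

end LinearAlgebra

set_option maxSynthPendingDepth 3
set_option synthInstance.maxHeartbeats 200000

open Set Filter Topology

/-! ### The Killing equation, submersions and linear relations in a normed space -/

section Analysis

variable {E : Type*} [NormedAddCommGroup E] [NormedSpace ℝ E]

/-- The Killing equation in coordinates, differentiated once in the direction `w`. -/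
theorem fderiv_killing_equation {G : E → E →L[ℝ] E →L[ℝ] ℝ} {Z : E → E} {S : Set E}
    (hS : IsOpen S) (hG : ContDiffOn ℝ 2 G S) (hZ : ContDiffOn ℝ 2 Z S)
    (hK : ∀ y ∈ S, ∀ u v, fderiv ℝ G y (Z y) u v + G y (fderiv ℝ Z y u) v
      + G y u (fderiv ℝ Z y v) = 0) {y : E} (hy : y ∈ S) (w u v : E) :
    fderiv ℝ (fderiv ℝ G) y w (Z y) u v + fderiv ℝ G y (fderiv ℝ Z y w) u v
      + fderiv ℝ G y w (fderiv ℝ Z y u) v + G y (fderiv ℝ (fderiv ℝ Z) y w u) v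
      + fderiv ℝ G y w u (fderiv ℝ Z y v) + G y u (fderiv ℝ (fderiv ℝ Z) y w v) = 0 := by
  have hGy := hG.contDiffAt (hS.mem_nhds hy)
  have hZy := hZ.contDiffAt (hS.mem_nhds hy)
  have dG := (hGy.differentiableAt (by norm_num)).hasFDerivAt
  have dZ := (hZy.differentiableAt (by norm_num)).hasFDerivAt
  have dG' := ((hGy.fderiv_right (m := 1) (by norm_num)).differentiableAt
    (by norm_num)).hasFDerivAt
  have dZ' := ((hZy.fderiv_right (m := 1) (by norm_num)).differentiableAt
    (by norm_num)).hasFDerivAt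
  have cu := hasFDerivAt_const (𝕜 := ℝ) u y
  have cv := hasFDerivAt_const (𝕜 := ℝ) v y
  have h := ((((dG'.clm_apply dZ).clm_apply cu).clm_apply cv).add
    ((dG.clm_apply (dZ'.clm_apply cu)).clm_apply cv)).add
    ((dG.clm_apply cu).clm_apply (dZ'.clm_apply cv))
  have h0 := (hasFDerivAt_const (𝕜 := ℝ) (0 : ℝ) y).congr_of_eventuallyEq
    (f₁ := fun y => fderiv ℝ G y (Z y) u v + G y (fderiv ℝ Z y u) v + G y u (fderiv ℝ Z y v))
    (by filter_upwards [hS.mem_nhds hy] with z hz using hK z hz u v)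
  have := congrArg (fun T : E →L[ℝ] ℝ => T w) (h.unique h0)
  simp at this
  linarith

/-- The first two derivatives of a `C^2` map are locally bounded. -/
theorem eventually_fderiv_bounds {F : Type*} [NormedAddCommGroup F] [NormedSpace ℝ F] {f : E → F}
    {y₀ : E} (hf : ContDiffAt ℝ 2 f y₀) : ∃ C : ℝ, 0 ≤ C ∧ ∀ᶠ y in 𝓝 y₀,
      (∀ w, ‖fderiv ℝ f y w‖ ≤ C * ‖w‖) ∧
        ∀ w z, ‖fderiv ℝ (fderiv ℝ f) y w z‖ ≤ C * ‖w‖ * ‖z‖ := by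
  have c' : ContinuousAt (fderiv ℝ f) y₀ :=
    (hf.fderiv_right (m := 1) (by norm_num)).continuousAt
  have c'' : ContinuousAt (fderiv ℝ (fderiv ℝ f)) y₀ :=
    ((hf.fderiv_right (m := 1) (by norm_num)).fderiv_right (m := 0) (by norm_num)).continuousAt
  have hb' : ∀ᶠ y in 𝓝 y₀, ‖fderiv ℝ f y‖ < ‖fderiv ℝ f y₀‖ + 1 :=
    c'.norm.eventually_lt_const (by linarith)
  have hb'' : ∀ᶠ y in 𝓝 y₀, ‖fderiv ℝ (fderiv ℝ f) y‖ < ‖fderiv ℝ (fderiv ℝ f) y₀‖ + 1 :=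
    c''.norm.eventually_lt_const (by linarith)
  refine ⟨max (‖fderiv ℝ f y₀‖ + 1) (‖fderiv ℝ (fderiv ℝ f) y₀‖ + 1), by positivity, ?_⟩
  filter_upwards [hb', hb''] with y h1 h2
  refine ⟨fun w => (ContinuousLinearMap.le_opNorm _ w).trans ?_,
    fun w z => (ContinuousLinearMap.le_opNorm₂ _ w z).trans ?_⟩
  · gcongr
    exact h1.le.trans (le_max_left _ _)
  · gcongr
    exact h2.le.trans (le_max_right _ _)

/-- A Killing field is determined by its first jet at a point, locally: its second derivatives are
linear combinations of the field and its first derivatives, exactly as the Christoffel symbols are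
obtained from the derivatives of the metric, so that Grönwall's inequality applies on the rays
issuing from the point. -/
theorem eventually_eq_zero_of_killing [FiniteDimensional ℝ E]
    {G : E → E →L[ℝ] E →L[ℝ] ℝ} {Z : E → E} {S : Set E}
    (hS : IsOpen S) (hG : ContDiffOn ℝ 2 G S) (hZ : ContDiffOn ℝ 2 Z S)
    (hsymm : ∀ y ∈ S, ∀ u v, G y u v = G y v u)
    (hK : ∀ y ∈ S, ∀ u v, fderiv ℝ G y (Z y) u v + G y (fderiv ℝ Z y u) v
      + G y u (fderiv ℝ Z y v) = 0) {y₀ : E} (hy₀ : y₀ ∈ S)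
    (hnd : ∀ u, (∀ v, G y₀ u v = 0) → u = 0)
    (h0 : Z y₀ = 0) (h1 : fderiv ℝ Z y₀ = 0) : ∀ᶠ y in 𝓝 y₀, Z y = 0 := by
  have hGy := hG.contDiffAt (hS.mem_nhds hy₀)
  obtain ⟨D, hD, hbounds⟩ := eventually_fderiv_bounds hGy
  -- a lower bound for the metric at the base point, which persists nearby
  obtain ⟨K, hKpos, hanti⟩ := (G y₀ : E →ₗ[ℝ] E →L[ℝ] ℝ).exists_antilipschitzWith (by
    rw [LinearMap.ker_eq_bot']
    intro u hu
    exact hnd u fun v => by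
      have : G y₀ u = 0 := hu
      rw [this]; rfl)
  have hlow₀ (a : E) : ‖a‖ ≤ K * ‖G y₀ a‖ := by
    simpa using ZeroHomClass.bound_of_antilipschitz (G y₀ : E →ₗ[ℝ] E →L[ℝ] ℝ) hanti a
  have hK' : (0 : ℝ) < K := by exact_mod_cast hKpos
  have hnear : ∀ᶠ y in 𝓝 y₀, ‖G y - G y₀‖ < 1 / (2 * K) := by
    have : Tendsto (fun y => ‖G y - G y₀‖) (𝓝 y₀) (𝓝 ‖G y₀ - G y₀‖) :=
      ((hGy.continuousAt.sub continuousAt_const).norm)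
    rw [sub_self, norm_zero] at this
    exact this.eventually_lt_const (by positivity)
  obtain ⟨r, hr, hball⟩ := Metric.eventually_nhds_iff_ball.mp
    ((hS.eventually_mem hy₀).and (hnear.and hbounds))
  set C := 4 * D with hCdef
  have hC : 0 ≤ C := by positivity
  -- the second derivatives are controlled by the first jet
  have hsecond (y : E) (hy : y ∈ Metric.ball y₀ r) :
      ‖fderiv ℝ (fderiv ℝ Z) y‖ ≤ 3 * K * C * ‖(Z y, fderiv ℝ Z y)‖ := by
    obtain ⟨hyS, hn, hC1, hC2⟩ := hball y hy
    set N := ‖(Z y, fderiv ℝ Z y)‖ with hN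
    have hZN : ‖Z y‖ ≤ N := norm_fst_le (Z y, fderiv ℝ Z y)
    have hZ'N : ‖fderiv ℝ Z y‖ ≤ N := norm_snd_le (Z y, fderiv ℝ Z y)
    have hN0 : 0 ≤ N := norm_nonneg _
    have hlow (a : E) : ‖a‖ ≤ 2 * K * ‖G y a‖ := by
      have e1 : ‖G y₀ a‖ ≤ ‖G y a‖ + ‖G y - G y₀‖ * ‖a‖ := by
        have : G y₀ a = G y a - (G y - G y₀) a := by simp
        rw [this]
        exact (norm_sub_le _ _).trans (by gcongr; exact ContinuousLinearMap.le_opNorm _ _)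
      have e2 : ‖G y - G y₀‖ * ‖a‖ ≤ 1 / (2 * K) * ‖a‖ := by gcongr
      have e3 : K * (1 / (2 * K) * ‖a‖) = ‖a‖ / 2 := by field_simp
      have e4 := mul_le_mul_of_nonneg_left (e1.trans (add_le_add_right e2 _)) hK'.le
      have := hlow₀ a
      rw [mul_add, e3] at e4
      linarith
    have hsym2 (w u : E) : fderiv ℝ (fderiv ℝ Z) y w u = fderiv ℝ (fderiv ℝ Z) y u w :=
      ((hZ.contDiffAt (hS.mem_nhds hyS)).isSymmSndFDerivAt (by simp)) w u
    have hR (w u v : E) : |G y (fderiv ℝ (fderiv ℝ Z) y w u) v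
        + G y u (fderiv ℝ (fderiv ℝ Z) y w v)| ≤ C * N * ‖w‖ * ‖u‖ * ‖v‖ := by
      have h := fderiv_killing_equation hS hG hZ hK hyS w u v
      have hap (T : E →L[ℝ] E →L[ℝ] ℝ) {c : ℝ} (hT : ‖T‖ ≤ c) {a b : E} {a' b' : ℝ}
          (ha : ‖a‖ ≤ a') (hb : ‖b‖ ≤ b') : |T a b| ≤ c * a' * b' := by
        have ha0 := (norm_nonneg a).trans ha
        have hc0 := (norm_nonneg T).trans hT
        calc |T a b| ≤ ‖T‖ * ‖a‖ * ‖b‖ := T.le_opNorm₂ a b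
          _ ≤ _ := by gcongr
      have hZ'a (a : E) : ‖fderiv ℝ Z y a‖ ≤ N * ‖a‖ :=
        ((fderiv ℝ Z y).le_opNorm a).trans (by gcongr)
      have t1 := hap (fderiv ℝ (fderiv ℝ G) y w (Z y)) ((hC2 _ _).trans
        (mul_le_mul_of_nonneg_left hZN (by positivity))) (le_refl ‖u‖) (le_refl ‖v‖)
      have t2 := hap (fderiv ℝ G y (fderiv ℝ Z y w)) ((hC1 _).trans
        (mul_le_mul_of_nonneg_left (hZ'a w) hD)) (le_refl ‖u‖) (le_refl ‖v‖)
      have t3 := hap (fderiv ℝ G y w) (hC1 w) (hZ'a u) (le_refl ‖v‖)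
      have t4 := hap (fderiv ℝ G y w) (hC1 w) (le_refl ‖u‖) (hZ'a v)
      have hCN : C * N * ‖w‖ * ‖u‖ * ‖v‖ = D * ‖w‖ * N * ‖u‖ * ‖v‖
          + D * (N * ‖w‖) * ‖u‖ * ‖v‖ + D * ‖w‖ * (N * ‖u‖) * ‖v‖
          + D * ‖w‖ * ‖u‖ * (N * ‖v‖) := by
        rw [hCdef]; ring
      rw [hCN, abs_le]
      rw [abs_le] at t1 t2 t3 t4
      constructor <;> linarith
    -- the Koszul combination of the three cyclic permutations isolates one second derivative
    have hT (w u v : E) : |G y (fderiv ℝ (fderiv ℝ Z) y w u) v|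
        ≤ 3 / 2 * C * N * ‖w‖ * ‖u‖ * ‖v‖ := by
      have a1 := hR w u v
      have a2 := hR u v w
      have a3 := hR v w u
      rw [hsym2 v w, hsym2 v u] at a3
      rw [hsym2 u w] at a2
      have s1 := hsymm y hyS u (fderiv ℝ (fderiv ℝ Z) y w v)
      have s2 := hsymm y hyS v (fderiv ℝ (fderiv ℝ Z) y w u)
      have s3 := hsymm y hyS w (fderiv ℝ (fderiv ℝ Z) y u v)
      rw [abs_le] at a1 a2 a3 ⊢
      constructor <;> nlinarith
    refine ContinuousLinearMap.opNorm_le_bound _ (by positivity) fun w => ?_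
    refine ContinuousLinearMap.opNorm_le_bound _ (by positivity) fun u => ?_
    have h2 : ‖G y (fderiv ℝ (fderiv ℝ Z) y w u)‖ ≤ 3 / 2 * C * N * ‖w‖ * ‖u‖ :=
      ContinuousLinearMap.opNorm_le_bound _ (by positivity) fun v => hT w u v
    calc _ ≤ 2 * K * ‖G y (fderiv ℝ (fderiv ℝ Z) y w u)‖ := hlow _
      _ ≤ 2 * K * (3 / 2 * C * N * ‖w‖ * ‖u‖) := by gcongr
      _ = _ := by ring
  refine Metric.eventually_nhds_iff_ball.mpr ⟨r, hr, fun y hy => ?_⟩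
  set v := y - y₀ with hv
  have hray (t : ℝ) (ht : t ∈ Icc (0 : ℝ) 1) : y₀ + t • v ∈ Metric.ball y₀ r := by
    have : ‖v‖ < r := by simpa [hv, dist_eq_norm] using hy
    rw [Metric.mem_ball, dist_eq_norm, add_sub_cancel_left, norm_smul, Real.norm_of_nonneg ht.1]
    calc t * ‖v‖ ≤ 1 * ‖v‖ := by gcongr; exact ht.2
      _ < r := by rwa [one_mul]
  have hder (t : ℝ) (ht : t ∈ Icc (0 : ℝ) 1) :
      HasDerivAt (fun t : ℝ => (Z (y₀ + t • v), fderiv ℝ Z (y₀ + t • v)))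
        (fderiv ℝ Z (y₀ + t • v) v, fderiv ℝ (fderiv ℝ Z) (y₀ + t • v) v) t := by
    have hyS := (hball _ (hray t ht)).1
    have hZy := hZ.contDiffAt (hS.mem_nhds hyS)
    have dl : HasDerivAt (fun t : ℝ => y₀ + t • v) v t := by
      simpa using ((hasDerivAt_id t).smul_const v).const_add y₀
    have dZ := (hZy.differentiableAt (by norm_num)).hasFDerivAt
    have dZ' := ((hZy.fderiv_right (m := 1) (by norm_num)).differentiableAt
      (by norm_num)).hasFDerivAt
    exact (dZ.comp_hasDerivAt t dl).prodMk (dZ'.comp_hasDerivAt t dl)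
  have := eq_zero_of_abs_deriv_le_mul_abs_self_of_eq_zero_right
    (f := fun t : ℝ => (Z (y₀ + t • v), fderiv ℝ Z (y₀ + t • v)))
    (f' := fun t : ℝ => (fderiv ℝ Z (y₀ + t • v) v, fderiv ℝ (fderiv ℝ Z) (y₀ + t • v) v))
    (K := (1 + 3 * K * C) * ‖v‖) (a := 0) (b := 1)
    (fun t ht => (hder t ht).continuousAt.continuousWithinAt)
    (fun t ht => (hder t ⟨ht.1, ht.2.le⟩).hasDerivWithinAt) (by simp [h0, h1]) (by
      intro t ht
      have hs := hsecond _ (hray t ⟨ht.1, ht.2.le⟩)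
      set z := y₀ + t • v
      set N := ‖(Z z, fderiv ℝ Z z)‖ with hN
      have hZ'N : ‖fderiv ℝ Z z‖ ≤ N := norm_snd_le (Z z, fderiv ℝ Z z)
      have hN0 : 0 ≤ N := norm_nonneg _
      rw [Prod.norm_def]
      refine max_le ?_ ?_
      · calc _ ≤ ‖fderiv ℝ Z z‖ * ‖v‖ := (fderiv ℝ Z z).le_opNorm v
          _ ≤ N * ‖v‖ := by gcongr
          _ ≤ (1 + 3 * K * C) * ‖v‖ * N := by
            have : 0 ≤ 3 * K * C * ‖v‖ * N := by positivity
            linarith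
      · calc _ ≤ ‖fderiv ℝ (fderiv ℝ Z) z‖ * ‖v‖ := (fderiv ℝ (fderiv ℝ Z) z).le_opNorm v
          _ ≤ (3 * K * C * N) * ‖v‖ := by gcongr
          _ ≤ (1 + 3 * K * C) * ‖v‖ * N := by
            have : 0 ≤ ‖v‖ * N := by positivity
            linarith) 1 ⟨zero_le_one, le_rfl⟩
  have h2 := congrArg Prod.fst this
  simpa [hv] using h2

/-- A ball punctured at its centre is connected in dimension at least two. -/
theorem isPreconnected_ball_diff_center {F : Type*} [NormedAddCommGroup F]
    [NormedSpace ℝ F] (hF : 1 < Module.rank ℝ F) {r : ℝ} (hr : 0 < r) :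
    IsPreconnected (Metric.ball (0 : F) r \ {0}) := by
  -- the punctured ball is the image of the punctured space under a radial contraction
  have h := (isConnected_compl_singleton_of_one_lt_rank hF (0 : F)).isPreconnected.image
    (fun x : F => (r / (1 + ‖x‖)) • x) (by
      have (x : F) : 1 + ‖x‖ ≠ 0 := by positivity
      fun_prop (disch := assumption))
  convert h using 1
  ext y
  simp only [Set.mem_sdiff, Metric.mem_ball, dist_zero_right, mem_singleton_iff, mem_image,
    mem_compl_iff]
  constructor
  · rintro ⟨hy, hy0⟩
    have hpos : 0 < r - ‖y‖ := by linarith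
    refine ⟨(r - ‖y‖)⁻¹ • y, smul_ne_zero (inv_ne_zero hpos.ne') hy0, ?_⟩
    rw [norm_smul, norm_inv, Real.norm_of_nonneg hpos.le, smul_smul]
    have : r / (1 + (r - ‖y‖)⁻¹ * ‖y‖) * (r - ‖y‖)⁻¹ = 1 := by
      have : 1 + (r - ‖y‖)⁻¹ * ‖y‖ = r / (r - ‖y‖) := by field_simp; ring
      rw [this]
      field_simp
    rw [this, one_smul]
  · rintro ⟨x, hx, rfl⟩
    have h1 : 0 < 1 + ‖x‖ := by positivity
    refine ⟨?_, smul_ne_zero (by positivity) hx⟩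
    rw [norm_smul, Real.norm_of_nonneg (by positivity), div_mul_eq_mul_div, div_lt_iff₀ h1]
    linarith

/-- The zero set of a submersion `f` onto a space of dimension at least two is nowhere dense and
does not disconnect small neighbourhoods of a point. -/
theorem exists_isOpen_preconnected_ne_zero [CompleteSpace E] {F : Type*} [NormedAddCommGroup F]
    [NormedSpace ℝ F] [FiniteDimensional ℝ F] {f : E → F} {f' : E →L[ℝ] F} {a : E}
    (hf : HasStrictFDerivAt f f' a) (hf' : f'.range = ⊤) (ha : f a = 0)
    (hF : 1 < Module.finrank ℝ F) {S : Set E} (hS : S ∈ 𝓝 a) :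
    ∃ T ⊆ S, IsOpen T ∧ a ∈ T ∧ IsPreconnected (T ∩ {y | f y ≠ 0}) ∧
      T ⊆ closure (T ∩ {y | f y ≠ 0}) := by
  have hrank : 1 < Module.rank ℝ F := Module.one_lt_rank_of_one_lt_finrank hF
  have : Nontrivial F := Module.nontrivial_of_finrank_pos (R := ℝ) (by omega)
  -- straighten `f` to a linear projection
  set Ψ := hf.implicitToOpenPartialHomeomorph f f' hf' with hΨ
  have hΨa : Ψ a = (0, 0) := by
    rw [hΨ, HasStrictFDerivAt.implicitToOpenPartialHomeomorph_self, ha]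
  have hfst (x : E) : (Ψ x).1 = f x :=
    HasStrictFDerivAt.implicitToOpenPartialHomeomorph_fst hf hf' x
  have haS : a ∈ Ψ.source := hf.mem_implicitToOpenPartialHomeomorph_source hf'
  have htgt : ((0, 0) : F × f'.ker) ∈ Ψ.target := hΨa ▸ Ψ.map_source haS
  have hsymm : Ψ.symm (0, 0) = a := by rw [← hΨa, Ψ.left_inv haS]
  have hmem : Ψ.target ∩ Ψ.symm ⁻¹' S ∈ 𝓝 ((0, 0) : F × f'.ker) := by
    refine inter_mem (Ψ.open_target.mem_nhds htgt) ?_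
    apply (Ψ.continuousAt_symm htgt).preimage_mem_nhds
    rwa [hsymm]
  obtain ⟨r, hr, hball⟩ := Metric.mem_nhds_iff.mp hmem
  rw [← ball_prod_same] at hball
  set W : Set (F × f'.ker) := Metric.ball 0 r ×ˢ Metric.ball 0 r with hW
  have hWopen : IsOpen W := Metric.isOpen_ball.prod Metric.isOpen_ball
  have hWt : W ⊆ Ψ.target := fun z hz => (hball hz).1
  have himg : Ψ.symm '' W ∩ {y | f y ≠ 0}
      = Ψ.symm '' ((Metric.ball 0 r \ {0}) ×ˢ Metric.ball 0 r) := by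
    ext y
    constructor
    · rintro ⟨⟨z, hz, rfl⟩, hne⟩
      refine ⟨z, ⟨⟨hz.1, ?_⟩, hz.2⟩, rfl⟩
      simp only [mem_ofPred_eq, ← hfst, Ψ.right_inv (hWt hz)] at hne
      exact hne
    · rintro ⟨z, hz, rfl⟩
      have hzW : z ∈ W := ⟨hz.1.1, hz.2⟩
      refine ⟨⟨z, hzW, rfl⟩, ?_⟩
      simp only [mem_ofPred_eq, ← hfst, Ψ.right_inv (hWt hzW)]
      exact hz.1.2
  have hsub : (Metric.ball (0 : F) r \ {0}) ×ˢ Metric.ball (0 : f'.ker) r ⊆ W :=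
    prod_mono sdiff_subset subset_rfl
  refine ⟨Ψ.symm '' W, ?_, Ψ.symm.isOpen_image_of_subset_source hWopen hWt,
    ⟨(0, 0), ⟨by simpa using hr, by simpa using hr⟩, hsymm⟩, ?_, ?_⟩
  · rintro _ ⟨z, hz, rfl⟩
    exact (hball hz).2
  · rw [himg]
    apply ((isPreconnected_ball_diff_center hrank hr).prod
      (convex_ball (0 : f'.ker) r).isPreconnected).image
    exact Ψ.continuousOn_symm.mono (hsub.trans hWt)
  · rw [himg]
    rintro _ ⟨z, hz, rfl⟩
    have hcl : z ∈ closure ((Metric.ball (0 : F) r \ {0}) ×ˢ Metric.ball (0 : f'.ker) r) := by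
      rw [closure_prod_eq]
      refine ⟨?_, subset_closure hz.2⟩
      have := (dense_compl_singleton (0 : F)).open_subset_closure_inter
        (Metric.isOpen_ball (x := (0 : F)) (ε := r)) hz.1
      rwa [← sdiff_eq] at this
    exact mem_closure_image (Ψ.continuousAt_symm (hWt hz)) hcl

/-- If `f + k • λ = 0` for a nondegenerate matrix `λ` of functions and a pair `k = (k₁, k₂)`, and
the same relation holds between the derivatives, then `λ dk = 0`, so that `k` is constant on
connected open sets. -/
theorem exists_const_of_fderiv_relation {f₁ f₂ l₁₁ l₁₂ l₂₂ : E → ℝ} {S : Set E}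
    (hS : IsOpen S) (hS' : IsPreconnected S)
    (hf₁ : DifferentiableOn ℝ f₁ S) (hf₂ : DifferentiableOn ℝ f₂ S)
    (hl₁₁ : DifferentiableOn ℝ l₁₁ S) (hl₁₂ : DifferentiableOn ℝ l₁₂ S)
    (hl₂₂ : DifferentiableOn ℝ l₂₂ S)
    (hD : ∀ y ∈ S, l₁₁ y * l₂₂ y - l₁₂ y * l₁₂ y ≠ 0)
    (hrel : ∀ y ∈ S, ∀ k₁ k₂ : ℝ, f₁ y + k₁ * l₁₁ y + k₂ * l₁₂ y = 0 →
      f₂ y + k₁ * l₁₂ y + k₂ * l₂₂ y = 0 → ∀ v,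
        fderiv ℝ f₁ y v + k₁ * fderiv ℝ l₁₁ y v + k₂ * fderiv ℝ l₁₂ y v = 0 ∧
        fderiv ℝ f₂ y v + k₁ * fderiv ℝ l₁₂ y v + k₂ * fderiv ℝ l₂₂ y v = 0) :
    ∃ k₁ k₂ : ℝ, ∀ y ∈ S, f₁ y + k₁ * l₁₁ y + k₂ * l₁₂ y = 0 ∧
      f₂ y + k₁ * l₁₂ y + k₂ * l₂₂ y = 0 := by
  -- Cramer's rule
  set k₁ : E → ℝ := fun y => (l₁₂ y * f₂ y - l₂₂ y * f₁ y) / (l₁₁ y * l₂₂ y - l₁₂ y * l₁₂ y)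
  set k₂ : E → ℝ := fun y => (l₁₂ y * f₁ y - l₁₁ y * f₂ y) / (l₁₁ y * l₂₂ y - l₁₂ y * l₁₂ y)
  have hk₁ : DifferentiableOn ℝ k₁ S := by
    simp only [k₁, div_eq_mul_inv]
    exact ((hl₁₂.mul hf₂).sub (hl₂₂.mul hf₁)).mul (((hl₁₁.mul hl₂₂).sub (hl₁₂.mul hl₁₂)).inv hD)
  have hk₂ : DifferentiableOn ℝ k₂ S := by
    simp only [k₂, div_eq_mul_inv]
    exact ((hl₁₂.mul hf₁).sub (hl₁₁.mul hf₂)).mul (((hl₁₁.mul hl₂₂).sub (hl₁₂.mul hl₁₂)).inv hD)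
  have e₁ (y : E) (hy : y ∈ S) : f₁ y + k₁ y * l₁₁ y + k₂ y * l₁₂ y = 0 := by
    have hd := mul_inv_cancel₀ (hD y hy)
    simp only [k₁, k₂, div_eq_mul_inv]
    linear_combination -f₁ y * hd
  have e₂ (y : E) (hy : y ∈ S) : f₂ y + k₁ y * l₁₂ y + k₂ y * l₂₂ y = 0 := by
    have hd := mul_inv_cancel₀ (hD y hy)
    simp only [k₁, k₂, div_eq_mul_inv]
    linear_combination -f₂ y * hd
  have hzero (y : E) (hy : y ∈ S) : fderiv ℝ k₁ y = 0 ∧ fderiv ℝ k₂ y = 0 := by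
    have hn := hS.mem_nhds hy
    have d₁ := (hf₁.differentiableAt hn).hasFDerivAt
    have d₂ := (hf₂.differentiableAt hn).hasFDerivAt
    have d₁₁ := (hl₁₁.differentiableAt hn).hasFDerivAt
    have d₁₂ := (hl₁₂.differentiableAt hn).hasFDerivAt
    have d₂₂ := (hl₂₂.differentiableAt hn).hasFDerivAt
    have c₁ := (hk₁.differentiableAt hn).hasFDerivAt
    have c₂ := (hk₂.differentiableAt hn).hasFDerivAt
    have z₁ := (hasFDerivAt_const (𝕜 := ℝ) (0 : ℝ) y).congr_of_eventuallyEq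
      (f₁ := fun y => f₁ y + k₁ y * l₁₁ y + k₂ y * l₁₂ y)
      (by filter_upwards [hn] with z hz using e₁ z hz)
    have z₂ := (hasFDerivAt_const (𝕜 := ℝ) (0 : ℝ) y).congr_of_eventuallyEq
      (f₁ := fun y => f₂ y + k₁ y * l₁₂ y + k₂ y * l₂₂ y)
      (by filter_upwards [hn] with z hz using e₂ z hz)
    have r₁ := ((d₁.add (c₁.mul d₁₁)).add (c₂.mul d₁₂)).unique z₁
    have r₂ := ((d₂.add (c₁.mul d₁₂)).add (c₂.mul d₂₂)).unique z₂
    have key (v : E) : fderiv ℝ k₁ y v = 0 ∧ fderiv ℝ k₂ y v = 0 := by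
      obtain ⟨h₁, h₂⟩ := hrel y hy _ _ (e₁ y hy) (e₂ y hy) v
      have r₁v := congrArg (fun T : E →L[ℝ] ℝ => T v) r₁
      have r₂v := congrArg (fun T : E →L[ℝ] ℝ => T v) r₂
      simp only [FunLike.coe_add, FunLike.coe_smul, Pi.add_apply, Pi.smul_apply, smul_eq_mul,
        FunLike.coe_zero, Pi.zero_apply] at r₁v r₂v
      have q₁ : l₁₁ y * fderiv ℝ k₁ y v + l₁₂ y * fderiv ℝ k₂ y v = 0 := by linarith
      have q₂ : l₁₂ y * fderiv ℝ k₁ y v + l₂₂ y * fderiv ℝ k₂ y v = 0 := by linarith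
      constructor
      · have : (l₁₁ y * l₂₂ y - l₁₂ y * l₁₂ y) * fderiv ℝ k₁ y v = 0 := by
          linear_combination l₂₂ y * q₁ - l₁₂ y * q₂
        exact (mul_eq_zero.mp this).resolve_left (hD y hy)
      · have : (l₁₁ y * l₂₂ y - l₁₂ y * l₁₂ y) * fderiv ℝ k₂ y v = 0 := by
          linear_combination l₁₁ y * q₂ - l₁₂ y * q₁
        exact (mul_eq_zero.mp this).resolve_left (hD y hy)
    exact ⟨ContinuousLinearMap.ext fun v => (key v).1, ContinuousLinearMap.ext fun v => (key v).2⟩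
  obtain ⟨a, ha⟩ := hS.exists_is_const_of_fderiv_eq_zero hS' hk₁ fun y hy => (hzero y hy).1
  obtain ⟨b, hb⟩ := hS.exists_is_const_of_fderiv_eq_zero hS' hk₂ fun y hy => (hzero y hy).2
  refine ⟨a, b, fun y hy => ?_⟩
  rw [← ha y hy, ← hb y hy]
  exact ⟨e₁ y hy, e₂ y hy⟩

end Analysis

/-! ### Coordinate expressions of fields and metric -/

section Charts

variable {M : Type*} [TopologicalSpace M] [ChartedSpace (EuclideanSpace ℝ (Fin 4)) M]

/-- The derivative at `y` of the inverse of the chart centred at `p`, an isomorphism from the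
coordinate space to the tangent space when `y` is in the target of the chart. -/
noncomputable def chartSymmDeriv (p : M) (y : EuclideanSpace ℝ (Fin 4)) :
    EuclideanSpace ℝ (Fin 4) →L[ℝ] TangentSpace (𝓡 4) ((extChartAt (𝓡 4) p).symm y) :=
  mfderiv 𝓘(ℝ, EuclideanSpace ℝ (Fin 4)) (𝓡 4) (extChartAt (𝓡 4) p).symm y

/-- The coordinate expression of the vector field `ξ` in the chart centred at `p`; it has no meaning
outside of the target of the chart. -/
noncomputable def chartField (p : M) (ξ : VecField M) :
    EuclideanSpace ℝ (Fin 4) → EuclideanSpace ℝ (Fin 4) :=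
  VectorField.mpullback 𝓘(ℝ, EuclideanSpace ℝ (Fin 4)) (𝓡 4) (extChartAt (𝓡 4) p).symm ξ

/-- The vector field on the domain of the chart centred at `p` whose coordinate expression is the
constant `u`; outside of this domain it has no meaning. -/
noncomputable def coordField (p : M) (u : EuclideanSpace ℝ (Fin 4)) : VecField M :=
  VectorField.mpullback (𝓡 4) 𝓘(ℝ, EuclideanSpace ℝ (Fin 4)) (extChartAt (𝓡 4) p) (fun _ ↦ u)

variable [IsManifold (𝓡 4) ∞ M]

theorem isManifold_one : IsManifold (𝓡 4) 1 M := .of_le (n := ∞) (by norm_cast)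

variable {p : M} {y : EuclideanSpace ℝ (Fin 4)}

theorem contMDiffAt_chart_symm (hy : y ∈ (extChartAt (𝓡 4) p).target) :
    ContMDiffAt 𝓘(ℝ, EuclideanSpace ℝ (Fin 4)) (𝓡 4) ∞ (extChartAt (𝓡 4) p).symm y :=
  (contMDiffOn_extChartAt_symm p).contMDiffAt ((isOpen_extChartAt_target p).mem_nhds hy)

theorem isInvertible_chartSymmDeriv (hy : y ∈ (extChartAt (𝓡 4) p).target) :
    (chartSymmDeriv p y).IsInvertible := by
  have := isManifold_one (M := M)
  have h := isInvertible_mfderivWithin_extChartAt_symm (I := 𝓡 4) hy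
  rwa [ModelWithCorners.range_eq_univ, mfderivWithin_univ] at h

theorem chartSymmDeriv_chartField (hy : y ∈ (extChartAt (𝓡 4) p).target) (ξ : VecField M) :
    chartSymmDeriv p y (chartField p ξ y) = ξ ((extChartAt (𝓡 4) p).symm y) := by
  obtain ⟨e, he⟩ := isInvertible_chartSymmDeriv hy
  change chartSymmDeriv p y ((chartSymmDeriv p y).inverse _) = _
  rw [← he, ContinuousLinearMap.inverse_equiv]
  exact e.apply_symm_apply _

theorem chartField_eq_of_chartSymmDeriv (hy : y ∈ (extChartAt (𝓡 4) p).target) {ξ : VecField M}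
    {u : EuclideanSpace ℝ (Fin 4)} (h : chartSymmDeriv p y u = ξ ((extChartAt (𝓡 4) p).symm y)) :
    chartField p ξ y = u := by
  obtain ⟨e, he⟩ := isInvertible_chartSymmDeriv hy
  rw [← chartSymmDeriv_chartField hy ξ, ← he] at h
  exact (e.injective h).symm

theorem chartSymmDeriv_injective (hy : y ∈ (extChartAt (𝓡 4) p).target) :
    Function.Injective (chartSymmDeriv p y) := by
  obtain ⟨e, he⟩ := isInvertible_chartSymmDeriv hy
  rw [← he]
  exact e.injective

theorem chartSymmDeriv_surjective (hy : y ∈ (extChartAt (𝓡 4) p).target) :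
    Function.Surjective (chartSymmDeriv p y) := by
  obtain ⟨e, he⟩ := isInvertible_chartSymmDeriv hy
  rw [← he]
  exact e.surjective

theorem coordField_apply (hy : y ∈ (extChartAt (𝓡 4) p).target) (u : EuclideanSpace ℝ (Fin 4)) :
    coordField p u ((extChartAt (𝓡 4) p).symm y) = chartSymmDeriv p y u := by
  have := isManifold_one (M := M)
  have h1 := mfderivWithin_extChartAt_symm_comp_mfderiv_extChartAt (I := 𝓡 4) hy
  have h2 := mfderiv_extChartAt_comp_mfderivWithin_extChartAt_symm (I := 𝓡 4) hy
  rw [ModelWithCorners.range_eq_univ, mfderivWithin_univ] at h1 h2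
  have := ContinuousLinearMap.inverse_eq h2 h1
  change ContinuousLinearMap.inverse _ u = _
  exact congrArg (fun T ↦ T u) this

theorem chartField_coordField (hy : y ∈ (extChartAt (𝓡 4) p).target)
    (u : EuclideanSpace ℝ (Fin 4)) : chartField p (coordField p u) y = u :=
  chartField_eq_of_chartSymmDeriv hy (coordField_apply hy u).symm

theorem smoothFieldAt_coordField {x : M} (hx : x ∈ (extChartAt (𝓡 4) p).source)
    (u : EuclideanSpace ℝ (Fin 4)) : SmoothFieldAt (coordField p u) x := by
  have := isManifold_one (M := M)
  rw [SmoothFieldAt]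
  refine ContMDiffAt.mpullback_vectorField_preimage (n := ∞) ?_ ?_ ?_ (by simp)
  · exact contMDiffAt_vectorSpace_iff_contDiffAt.mpr contDiffAt_const
  · exact contMDiffAt_extChartAt' (by rwa [extChartAt_source] at hx)
  · exact isInvertible_mfderiv_extChartAt hx

theorem contDiffAt_chartField (hy : y ∈ (extChartAt (𝓡 4) p).target) {ξ : VecField M}
    (hξ : SmoothFieldAt ξ ((extChartAt (𝓡 4) p).symm y)) : ContDiffAt ℝ ∞ (chartField p ξ) y := by
  have := isManifold_one (M := M)
  refine contMDiffAt_vectorSpace_iff_contDiffAt.mp ?_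
  refine ContMDiffAt.mpullback_vectorField_preimage (n := ∞) hξ (contMDiffAt_chart_symm hy)
    (isInvertible_chartSymmDeriv hy) (by simp)

theorem fderiv_comp_chart_symm (hy : y ∈ (extChartAt (𝓡 4) p).target) {f : M → ℝ}
    (hf : MDifferentiableAt (𝓡 4) 𝓘(ℝ, ℝ) f ((extChartAt (𝓡 4) p).symm y))
    (v : EuclideanSpace ℝ (Fin 4)) :
    fderiv ℝ (fun z ↦ f ((extChartAt (𝓡 4) p).symm z)) y v
      = dirDeriv f ((extChartAt (𝓡 4) p).symm y) (chartSymmDeriv p y v) := by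
  have h := mfderiv_comp y hf ((contMDiffAt_chart_symm hy).mdifferentiableAt (by simp))
  rw [mfderiv_eq_fderiv] at h
  exact congrArg (fun T : EuclideanSpace ℝ (Fin 4) →L[ℝ] ℝ ↦ T v) h

theorem lieBracket_chartField (hy : y ∈ (extChartAt (𝓡 4) p).target) {ξ η : VecField M}
    (hξ : SmoothFieldAt ξ ((extChartAt (𝓡 4) p).symm y))
    (hη : SmoothFieldAt η ((extChartAt (𝓡 4) p).symm y)) :
    chartSymmDeriv p y (VectorField.lieBracket ℝ (chartField p ξ) (chartField p η) y)
      = VectorField.mlieBracket (𝓡 4) ξ η ((extChartAt (𝓡 4) p).symm y) := by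
  have : IsManifold (𝓡 4) (minSmoothness ℝ 3) M :=
    .of_le (n := ∞) (by simp; norm_cast)
  have h := VectorField.mpullback_mlieBracket (I := 𝓘(ℝ, EuclideanSpace ℝ (Fin 4))) (I' := 𝓡 4)
    (f := (extChartAt (𝓡 4) p).symm) (V := ξ) (W := η) (x₀ := y) (n := ∞)
    (hξ.mdifferentiableAt (by simp)) (hη.mdifferentiableAt (by simp)) (contMDiffAt_chart_symm hy)
    (by simp; norm_cast)
  have h' : chartField p (VectorField.mlieBracket (𝓡 4) ξ η) y
      = VectorField.mlieBracket 𝓘(ℝ, EuclideanSpace ℝ (Fin 4)) (chartField p ξ)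
          (chartField p η) y := h
  have hE (V W : EuclideanSpace ℝ (Fin 4) → EuclideanSpace ℝ (Fin 4)) :
      VectorField.mlieBracket 𝓘(ℝ, EuclideanSpace ℝ (Fin 4)) V W y
        = VectorField.lieBracket ℝ V W y := by
    have := congrFun (VectorField.mlieBracketWithin_eq_lieBracketWithin (𝕜 := ℝ) (V := V) (W := W)
      (s := univ)) y
    rw [VectorField.lieBracketWithin_univ] at this
    exact this
  rw [← chartSymmDeriv_chartField hy (VectorField.mlieBracket (𝓡 4) ξ η), h', hE]

variable (g : LorentzianMetric M)

/-- The coordinate expression of the metric in the chart centred at `p`. -/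
noncomputable def chartMetric (p : M) (y : EuclideanSpace ℝ (Fin 4)) :
    EuclideanSpace ℝ (Fin 4) →L[ℝ] EuclideanSpace ℝ (Fin 4) →L[ℝ] ℝ :=
  letI B : EuclideanSpace ℝ (Fin 4) →L[ℝ] EuclideanSpace ℝ (Fin 4) →L[ℝ] ℝ :=
    g.val ((extChartAt (𝓡 4) p).symm y)
  letI A : EuclideanSpace ℝ (Fin 4) →L[ℝ] EuclideanSpace ℝ (Fin 4) := chartSymmDeriv p y
  B.bilinearComp A A

/-- The function `g(ξ, η)`. -/
noncomputable def metricProd (ξ η : VecField M) (x : M) : ℝ := g.val x (ξ x) (η x)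

variable {g} {ξ η : VecField M} {x : M}

theorem metricProd_comm (ξ η : VecField M) : metricProd g ξ η = metricProd g η ξ :=
  funext fun x ↦ g.symm x _ _

theorem contMDiffAt_metricProd (hξ : SmoothFieldAt ξ x) (hη : SmoothFieldAt η x) :
    ContMDiffAt (𝓡 4) 𝓘(ℝ, ℝ) ∞ (metricProd g ξ η) x := by
  have := isManifold_one (M := M)
  have h : ContMDiffAt (𝓡 4) ((𝓡 4).prod 𝓘(ℝ)) ∞
      (fun m ↦ Bundle.TotalSpace.mk' ℝ (E := Bundle.Trivial M ℝ) m (g.val m (ξ m) (η m))) x := by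
    apply ContMDiffAt.clm_bundle_apply₂ (F₁ := EuclideanSpace ℝ (Fin 4))
      (F₂ := EuclideanSpace ℝ (Fin 4))
    · exact g.contMDiff.contMDiffAt
    · exact hξ
    · exact hη
  simp only [Bundle.contMDiffAt_totalSpace] at h
  exact h.2

theorem mdifferentiableAt_metricProd (hξ : SmoothFieldAt ξ x) (hη : SmoothFieldAt η x) :
    MDifferentiableAt (𝓡 4) 𝓘(ℝ, ℝ) (metricProd g ξ η) x :=
  (contMDiffAt_metricProd hξ hη).mdifferentiableAt (by simp)

theorem chartMetric_apply (u v : EuclideanSpace ℝ (Fin 4)) : chartMetric g p y u v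
    = g.val ((extChartAt (𝓡 4) p).symm y) (chartSymmDeriv p y u) (chartSymmDeriv p y v) := rfl

theorem chartMetric_symm (u v : EuclideanSpace ℝ (Fin 4)) :
    chartMetric g p y u v = chartMetric g p y v u :=
  g.symm _ _ _

theorem chartMetric_chartField (hy : y ∈ (extChartAt (𝓡 4) p).target) (ξ η : VecField M) :
    chartMetric g p y (chartField p ξ y) (chartField p η y)
      = metricProd g ξ η ((extChartAt (𝓡 4) p).symm y) := by
  rw [chartMetric_apply, chartSymmDeriv_chartField hy, chartSymmDeriv_chartField hy]
  rfl

theorem contDiffOn_chartMetric (g : LorentzianMetric M) (p : M) :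
    ContDiffOn ℝ ∞ (chartMetric g p) (extChartAt (𝓡 4) p).target := by
  rw [contDiffOn_clm_apply]
  intro u
  rw [contDiffOn_clm_apply]
  intro v z hz
  have hs := (extChartAt (𝓡 4) p).map_target hz
  have h := ((contMDiffAt_metricProd (g := g) (smoothFieldAt_coordField hs u)
    (smoothFieldAt_coordField hs v)).comp z (contMDiffAt_chart_symm hz)).contDiffAt
  refine (h.contDiffWithinAt (s := (extChartAt (𝓡 4) p).target)).congr_of_mem
    (fun w hw ↦ ?_) hz
  rw [Function.comp_apply, ← chartMetric_chartField hw, chartField_coordField hw,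
    chartField_coordField hw]

theorem differentiableAt_chartMetric (hy : y ∈ (extChartAt (𝓡 4) p).target) :
    DifferentiableAt ℝ (chartMetric g p) y :=
  ((contDiffOn_chartMetric g p).contDiffAt
    ((isOpen_extChartAt_target p).mem_nhds hy)).differentiableAt (by simp)

theorem differentiableAt_chartField (hy : y ∈ (extChartAt (𝓡 4) p).target)
    (hξ : SmoothFieldAt ξ ((extChartAt (𝓡 4) p).symm y)) :
    DifferentiableAt ℝ (chartField p ξ) y :=
  (contDiffAt_chartField hy hξ).differentiableAt (by simp)

/-- The Killing equation in coordinates. -/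
theorem chart_killing (hy : y ∈ (extChartAt (𝓡 4) p).target) (hξ : IsKilling g ξ)
    (u v : EuclideanSpace ℝ (Fin 4)) :
    fderiv ℝ (chartMetric g p) y (chartField p ξ y) u v
      + chartMetric g p y (fderiv ℝ (chartField p ξ) y u) v
      + chartMetric g p y u (fderiv ℝ (chartField p ξ) y v) = 0 := by
  have hs := (extChartAt (𝓡 4) p).map_target hy
  have hn := (isOpen_extChartAt_target (I := 𝓡 4) p).mem_nhds hy
  have hsu := smoothFieldAt_coordField hs u
  have hsv := smoothFieldAt_coordField hs v
  have hK := hξ.2 _ _ _ hsu hsv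
  have hbr (w : EuclideanSpace ℝ (Fin 4)) :
      VectorField.lieBracket ℝ (chartField p ξ) (chartField p (coordField p w)) y
        = - fderiv ℝ (chartField p ξ) y w := by
    have he : chartField p (coordField p w) =ᶠ[𝓝 y] fun _ ↦ w := by
      filter_upwards [hn] with z hz using chartField_coordField hz w
    rw [VectorField.lieBracket_eq]
    simp only [he.fderiv_eq, chartField_coordField hy]
    simp
  have hL : dirDeriv (metricProd g (coordField p u) (coordField p v))
      ((extChartAt (𝓡 4) p).symm y) (ξ ((extChartAt (𝓡 4) p).symm y))
      = fderiv ℝ (chartMetric g p) y (chartField p ξ y) u v := by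
    rw [← chartSymmDeriv_chartField hy ξ, ← fderiv_comp_chart_symm hy
      (mdifferentiableAt_metricProd hsu hsv)]
    have he : (fun z ↦ metricProd g (coordField p u) (coordField p v)
        ((extChartAt (𝓡 4) p).symm z)) =ᶠ[𝓝 y] fun z ↦ chartMetric g p z u v := by
      filter_upwards [hn] with z hz
      rw [← chartMetric_chartField hz, chartField_coordField hz, chartField_coordField hz]
    have hd := (((differentiableAt_chartMetric (g := g) hy).hasFDerivAt.clm_apply
      (hasFDerivAt_const (𝕜 := ℝ) u y)).clm_apply (hasFDerivAt_const (𝕜 := ℝ) v y)).fderiv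
    rw [he.fderiv_eq, hd]
    simp
  rw [← lieBracket_chartField hy (hξ.1 _) hsu, ← lieBracket_chartField hy (hξ.1 _) hsv, hbr, hbr,
    coordField_apply hy, coordField_apply hy, ← chartMetric_apply, ← chartMetric_apply] at hK
  change dirDeriv (metricProd g _ _) _ _ = _ at hK
  rw [hL] at hK
  simp only [map_neg, FunLike.coe_neg, Pi.neg_apply] at hK
  linarith

/-- Commuting vector fields in coordinates. -/
theorem chart_commute (hy : y ∈ (extChartAt (𝓡 4) p).target)
    (hξ : SmoothFieldAt ξ ((extChartAt (𝓡 4) p).symm y))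
    (hη : SmoothFieldAt η ((extChartAt (𝓡 4) p).symm y))
    (h : VectorField.mlieBracket (𝓡 4) ξ η ((extChartAt (𝓡 4) p).symm y) = 0) :
    fderiv ℝ (chartField p η) y (chartField p ξ y)
      = fderiv ℝ (chartField p ξ) y (chartField p η y) := by
  rw [← lieBracket_chartField hy hξ hη] at h
  have := chartSymmDeriv_injective hy (h.trans (map_zero _).symm)
  rw [VectorField.lieBracket_eq] at this
  exact sub_eq_zero.mp this

/-- The coordinate expression of the one-form `g(ξ, ·)`. -/
noncomputable def chartFlat (g : LorentzianMetric M) (p : M) (ξ : VecField M)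
    (y : EuclideanSpace ℝ (Fin 4)) :
    EuclideanSpace ℝ (Fin 4) →L[ℝ] ℝ :=
  chartMetric g p y (chartField p ξ y)

theorem contDiffAt_chartFlat (hy : y ∈ (extChartAt (𝓡 4) p).target)
    (hξ : SmoothFieldAt ξ ((extChartAt (𝓡 4) p).symm y)) :
    ContDiffAt ℝ ∞ (chartFlat g p ξ) y :=
  ((contDiffOn_chartMetric g p).contDiffAt
    ((isOpen_extChartAt_target p).mem_nhds hy)).clm_apply (contDiffAt_chartField hy hξ)

/-- The exterior derivative of `g(ξ, ·)` in coordinates. It shows in particular that the values of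
the exterior derivative only depend on the values of the vector fields at the point. -/
theorem extDerivOneForm_flat (hy : y ∈ (extChartAt (𝓡 4) p).target) {X Y : VecField M}
    (hξ : SmoothFieldAt ξ ((extChartAt (𝓡 4) p).symm y))
    (hX : SmoothFieldAt X ((extChartAt (𝓡 4) p).symm y))
    (hY : SmoothFieldAt Y ((extChartAt (𝓡 4) p).symm y)) :
    extDerivOneForm (flat g ξ) X Y ((extChartAt (𝓡 4) p).symm y)
      = fderiv ℝ (chartFlat g p ξ) y (chartField p X y) (chartField p Y y)
        - fderiv ℝ (chartFlat g p ξ) y (chartField p Y y) (chartField p X y) := by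
  have hn := (isOpen_extChartAt_target (I := 𝓡 4) p).mem_nhds hy
  have key {X Y : VecField M} (hX : SmoothFieldAt X ((extChartAt (𝓡 4) p).symm y))
      (hY : SmoothFieldAt Y ((extChartAt (𝓡 4) p).symm y)) :
      dirDeriv (metricProd g ξ Y) ((extChartAt (𝓡 4) p).symm y) (X ((extChartAt (𝓡 4) p).symm y))
        = fderiv ℝ (chartFlat g p ξ) y (chartField p X y) (chartField p Y y)
          + chartFlat g p ξ y (fderiv ℝ (chartField p Y) y (chartField p X y)) := by
    rw [← chartSymmDeriv_chartField hy X, ← fderiv_comp_chart_symm hy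
      (mdifferentiableAt_metricProd hξ hY)]
    have he : (fun z ↦ metricProd g ξ Y ((extChartAt (𝓡 4) p).symm z))
        =ᶠ[𝓝 y] fun z ↦ chartFlat g p ξ z (chartField p Y z) := by
      filter_upwards [hn] with z hz
      rw [← chartMetric_chartField hz, chartFlat]
    have hd := (((contDiffAt_chartFlat (g := g) hy hξ).differentiableAt
      (by simp)).hasFDerivAt.clm_apply (differentiableAt_chartField hy hY).hasFDerivAt).fderiv
    rw [he.fderiv_eq, hd]
    simp [add_comm]
  have hb : flat g ξ ((extChartAt (𝓡 4) p).symm y)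
      (VectorField.mlieBracket (𝓡 4) X Y ((extChartAt (𝓡 4) p).symm y))
      = chartFlat g p ξ y (fderiv ℝ (chartField p Y) y (chartField p X y))
        - chartFlat g p ξ y (fderiv ℝ (chartField p X) y (chartField p Y y)) := by
    rw [← lieBracket_chartField hy hX hY, flat, ← chartSymmDeriv_chartField hy ξ,
      ← chartMetric_apply, VectorField.lieBracket_eq, ← map_sub]
    rfl
  rw [extDerivOneForm, hb]
  change dirDeriv (metricProd g ξ Y) _ _ - dirDeriv (metricProd g ξ X) _ _ - _ = _
  rw [key hX hY, key hY hX]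
  ring

end Charts

/-! ### Exterior derivatives, Killing fields and orthogonal transitivity -/

section Permutations

theorem sum_perm_fin_three (f : Fin 3 → Fin 3 → Fin 3 → ℝ) :
    ∑ σ : Equiv.Perm (Fin 3), ((Equiv.Perm.sign σ : ℤ) : ℝ) * f (σ 0) (σ 1) (σ 2)
      = f 0 1 2 - f 0 2 1 - f 1 0 2 + f 1 2 0 + f 2 0 1 - f 2 1 0 := by
  have e (p : Fin 3) (e : Equiv.Perm (Fin 2)) :
      Equiv.Perm.decomposeFin.symm (p, e) 2 = Equiv.swap 0 p (e 1).succ :=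
    Equiv.Perm.decomposeFin_symm_apply_succ e p 1
  simp [Finset.univ_perm_fin_succ, ← Finset.univ_product_univ, Finset.sum_product,
    Fin.sum_univ_succ, Equiv.Perm.decomposeFin.symm_sign, Equiv.swap_apply_def, e]
  ring

theorem sum_perm_fin_four (f : Fin 4 → Fin 4 → Fin 4 → Fin 4 → ℝ) :
    ∑ σ : Equiv.Perm (Fin 4), ((Equiv.Perm.sign σ : ℤ) : ℝ) * f (σ 0) (σ 1) (σ 2) (σ 3)
      = (f 0 1 2 3 - f 0 1 3 2) - (f 0 2 1 3 - f 0 2 3 1) + (f 0 3 1 2 - f 0 3 2 1)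
        - (f 1 0 2 3 - f 1 0 3 2) + (f 1 2 0 3 - f 1 2 3 0) - (f 1 3 0 2 - f 1 3 2 0)
        + (f 2 0 1 3 - f 2 0 3 1) - (f 2 1 0 3 - f 2 1 3 0) + (f 2 3 0 1 - f 2 3 1 0)
        - (f 3 0 1 2 - f 3 0 2 1) + (f 3 1 0 2 - f 3 1 2 0) - (f 3 2 0 1 - f 3 2 1 0) := by
  have e (p : Fin 3) (e : Equiv.Perm (Fin 2)) :
      Equiv.Perm.decomposeFin.symm (p, e) 2 = Equiv.swap 0 p (e 1).succ :=
    Equiv.Perm.decomposeFin_symm_apply_succ e p 1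
  have e₂ (p : Fin 4) (e : Equiv.Perm (Fin 3)) :
      Equiv.Perm.decomposeFin.symm (p, e) 2 = Equiv.swap 0 p (e 1).succ :=
    Equiv.Perm.decomposeFin_symm_apply_succ e p 1
  have e₃ (p : Fin 4) (e : Equiv.Perm (Fin 3)) :
      Equiv.Perm.decomposeFin.symm (p, e) 3 = Equiv.swap 0 p (e 2).succ :=
    Equiv.Perm.decomposeFin_symm_apply_succ e p 2
  simp [Finset.univ_perm_fin_succ, ← Finset.univ_product_univ, Finset.sum_product,
    Fin.sum_univ_succ, Equiv.Perm.decomposeFin.symm_sign, Equiv.swap_apply_def, e, e₂, e₃]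
  ring

end Permutations

section Killing

variable {M : Type*} [TopologicalSpace M] [ChartedSpace (EuclideanSpace ℝ (Fin 4)) M]

theorem extDerivOneForm_swap (α : OneForm M) (X Y : VecField M) (x : M) :
    extDerivOneForm α X Y x = - extDerivOneForm α Y X x := by
  rw [extDerivOneForm, extDerivOneForm, VectorField.mlieBracket_swap_apply, map_neg]
  ring

theorem wedgeExtDeriv_eq (α β : OneForm M) (X : Fin 3 → VecField M) (x : M) :
    wedgeExtDeriv α β X x = α x (X 0 x) * extDerivOneForm β (X 1) (X 2) x
      + α x (X 1 x) * extDerivOneForm β (X 2) (X 0) x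
      + α x (X 2 x) * extDerivOneForm β (X 0) (X 1) x := by
  have e := sum_perm_fin_three
    (fun i j k ↦ α x (X i x) * extDerivOneForm β (X j) (X k) x)
  rw [wedgeExtDeriv, e, extDerivOneForm_swap β (X 2) (X 1), extDerivOneForm_swap β (X 0) (X 2),
    extDerivOneForm_swap β (X 1) (X 0)]
  ring

theorem wedgeWedgeExtDeriv_eq (α β γ : OneForm M) (X : Fin 4 → VecField M) (x : M) :
    wedgeWedgeExtDeriv α β γ X x
      = (α x (X 0 x) * β x (X 1 x) - α x (X 1 x) * β x (X 0 x))
          * extDerivOneForm γ (X 2) (X 3) x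
        - (α x (X 0 x) * β x (X 2 x) - α x (X 2 x) * β x (X 0 x))
          * extDerivOneForm γ (X 1) (X 3) x
        + (α x (X 0 x) * β x (X 3 x) - α x (X 3 x) * β x (X 0 x))
          * extDerivOneForm γ (X 1) (X 2) x
        + (α x (X 1 x) * β x (X 2 x) - α x (X 2 x) * β x (X 1 x))
          * extDerivOneForm γ (X 0) (X 3) x
        - (α x (X 1 x) * β x (X 3 x) - α x (X 3 x) * β x (X 1 x))
          * extDerivOneForm γ (X 0) (X 2) x
        + (α x (X 2 x) * β x (X 3 x) - α x (X 3 x) * β x (X 2 x))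
          * extDerivOneForm γ (X 0) (X 1) x := by
  have e := sum_perm_fin_four
    (fun i j k l ↦ α x (X i x) * β x (X j x) * extDerivOneForm γ (X k) (X l) x)
  rw [wedgeWedgeExtDeriv, e, extDerivOneForm_swap γ (X 3) (X 2), extDerivOneForm_swap γ (X 3) (X 1),
    extDerivOneForm_swap γ (X 2) (X 1), extDerivOneForm_swap γ (X 3) (X 0),
    extDerivOneForm_swap γ (X 2) (X 0), extDerivOneForm_swap γ (X 1) (X 0)]
  ring

variable [IsManifold (𝓡 4) ∞ M]

theorem exists_smoothFieldAt_eq (x : M) (v : TangentSpace (𝓡 4) x) :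
    ∃ X : VecField M, SmoothFieldAt X x ∧ X x = v := by
  have key : ∀ v : TangentSpace (𝓡 4) ((extChartAt (𝓡 4) x).symm (extChartAt (𝓡 4) x x)),
      ∃ X : VecField M, SmoothFieldAt X ((extChartAt (𝓡 4) x).symm (extChartAt (𝓡 4) x x)) ∧
        X ((extChartAt (𝓡 4) x).symm (extChartAt (𝓡 4) x x)) = v := by
    intro v
    have hy := mem_extChartAt_target (I := 𝓡 4) x
    obtain ⟨u, rfl⟩ := chartSymmDeriv_surjective hy v
    exact ⟨coordField x u, smoothFieldAt_coordField ((extChartAt (𝓡 4) x).map_target hy) u,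
      coordField_apply hy u⟩
  rw [extChartAt_to_inv] at key
  exact key v

variable {g : LorentzianMetric M} {ξ η τ X : VecField M} {x : M}

/-- Cartan's formula: the Lie derivative along `τ` of the one-form `g(ξ, ·)` vanishes, hence the
contraction of its exterior derivative with `τ` is `-d(g(ξ, τ))`. -/
theorem extDerivOneForm_flat_killing (hτ : IsKilling g τ) (hξ : SmoothFieldAt ξ x)
    (hX : SmoothFieldAt X x) (hc : VectorField.mlieBracket (𝓡 4) τ ξ x = 0) :
    extDerivOneForm (flat g ξ) τ X x = - dirDeriv (metricProd g ξ τ) x (X x) := by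
  have h := hτ.2 x ξ X hξ hX
  rw [hc, map_zero] at h
  change dirDeriv (fun y ↦ g.val y (ξ y) (X y)) x (τ x) - dirDeriv (metricProd g ξ τ) x (X x)
    - g.val x (ξ x) (VectorField.mlieBracket (𝓡 4) τ X x) = _
  rw [h]
  simp

theorem dirDeriv_metricProd_killing (hτ : IsKilling g τ) (hξ : SmoothFieldAt ξ x)
    (hη : SmoothFieldAt η x) (hcξ : VectorField.mlieBracket (𝓡 4) τ ξ x = 0)
    (hcη : VectorField.mlieBracket (𝓡 4) τ η x = 0) :
    dirDeriv (metricProd g ξ η) x (τ x) = 0 := by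
  have h := hτ.2 x ξ η hξ hη
  rw [hcξ, hcη] at h
  change dirDeriv (metricProd g ξ η) x (τ x) = _ at h
  simpa using h

/-- Let `s` be a Killing field of the group which at the point `x` is orthogonal to the orbit of
the two-parameter group. Evaluating the forms of orthogonal transitivity on `ξ`, `η`, `s` and a
fourth field shows that the products of `s` with `ξ` and `η` vanish at `x` to second order. -/
theorem dirDeriv_metricProd_eq_zero_of_orthogonal {𝔤 𝔥 : Submodule ℝ (VecField M)} {r : ℕ}
    (h𝔤 : IsAbelianIsometryGroup g r 𝔤) (hle : 𝔥 ≤ 𝔤) (hort : ActsOrthogonallyTransitively g 𝔥)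
    {s : VecField M} (hξ : ξ ∈ 𝔥) (hη : η ∈ 𝔥) (hs : s ∈ 𝔤)
    (hD : metricProd g ξ ξ x * metricProd g η η x - metricProd g ξ η x * metricProd g ξ η x ≠ 0)
    (hsξ : metricProd g ξ s x = 0) (hsη : metricProd g η s x = 0) (v : TangentSpace (𝓡 4) x) :
    dirDeriv (metricProd g ξ s) x v = 0 ∧ dirDeriv (metricProd g η s) x v = 0 := by
  obtain ⟨X, hX, rfl⟩ := exists_smoothFieldAt_eq x v
  have hsm {ζ : VecField M} (hζ : ζ ∈ 𝔤) : SmoothFieldAt ζ x := (h𝔤.killing ζ hζ).1 x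
  have h := hort ξ hξ η hη x ![ξ, η, s, X] (by
    intro i
    fin_cases i
    exacts [hsm (hle hξ), hsm (hle hη), hsm hs, hX])
  -- the exterior derivatives vanish on pairs of Killing fields of the group
  have hkk {γ a b : VecField M} (hγ : γ ∈ 𝔤) (ha : a ∈ 𝔤) (hb : b ∈ 𝔤) :
      extDerivOneForm (flat g γ) a b x = 0 := by
    rw [extDerivOneForm_flat_killing (h𝔤.killing a ha) (hsm hγ) (hsm hb) (h𝔤.commute a ha γ hγ x),
      dirDeriv_metricProd_killing (h𝔤.killing b hb) (hsm hγ) (hsm ha) (h𝔤.commute b hb γ hγ x)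
        (h𝔤.commute b hb a ha x), neg_zero]
  have hkX {γ : VecField M} (hγ : γ ∈ 𝔤) :
      extDerivOneForm (flat g γ) s X x = - dirDeriv (metricProd g γ s) x (X x) :=
    extDerivOneForm_flat_killing (h𝔤.killing s hs) (hsm hγ) hX (h𝔤.commute s hs γ hγ x)
  have hηξ : metricProd g η ξ x = metricProd g ξ η x := g.symm _ _ _
  simp only [wedgeWedgeExtDeriv_eq, Matrix.cons_val] at h
  have e (a b : VecField M) : flat g a x (b x) = metricProd g a b x := rfl
  simp only [e, hsξ, hsη, hηξ, hkk (hle hξ) (hle hξ) (hle hη), hkk (hle hξ) (hle hξ) hs,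
    hkk (hle hξ) (hle hη) hs, hkk (hle hη) (hle hξ) (hle hη), hkk (hle hη) (hle hξ) hs,
    hkk (hle hη) (hle hη) hs, hkX (hle hξ), hkX (hle hη)] at h
  constructor
  · refine (mul_eq_zero.mp (?_ : (metricProd g ξ ξ x * metricProd g η η x
      - metricProd g ξ η x * metricProd g ξ η x) * _ = 0)).resolve_left hD
    linear_combination - h.1
  · refine (mul_eq_zero.mp (?_ : (metricProd g ξ ξ x * metricProd g η η x
      - metricProd g ξ η x * metricProd g ξ η x) * _ = 0)).resolve_left hD
    linear_combination - h.2

end Killing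

/-! ### Orbits of the two-parameter group -/

section Orbits

variable {M : Type*} [TopologicalSpace M] [ChartedSpace (EuclideanSpace ℝ (Fin 4)) M]

/-- The group generated by `𝔥` acts freely at `x`, infinitesimally: no nonzero generator vanishes
at `x`. -/
def IsFreeAt (𝔥 : Submodule ℝ (VecField M)) (x : M) : Prop :=
  ∀ ζ ∈ 𝔥, ζ x = 0 → ζ = 0

theorem isFreeAt_of_finrank_orbitTangent {𝔥 : Submodule ℝ (VecField M)} [Module.Finite ℝ 𝔥] {x : M}
    (hx : Module.finrank ℝ (orbitTangent 𝔥 x) = Module.finrank ℝ 𝔥) : IsFreeAt 𝔥 x := by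
  intro ζ hζ h0
  set f := (LinearMap.proj x : VecField M →ₗ[ℝ] TangentSpace (𝓡 4) x).domRestrict 𝔥 with hf
  have h1 := f.finrank_range_add_finrank_ker
  have h1' : Module.finrank ℝ f.range = Module.finrank ℝ (orbitTangent 𝔥 x) := by
    rw [hf, LinearMap.range_domRestrict]
    rfl
  rw [h1', hx] at h1
  have h2 : f.ker = ⊥ := Submodule.finrank_eq_zero.mp (Nat.add_eq_left.mp h1)
  have h3 : (⟨ζ, hζ⟩ : 𝔥) ∈ f.ker := h0
  rw [h2, Submodule.mem_bot] at h3
  exact congrArg Subtype.val h3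

variable [IsManifold (𝓡 4) ∞ M] {g : LorentzianMetric M} {𝔤 𝔥 : Submodule ℝ (VecField M)}
  {ξ η ζ : VecField M} {x : M}

theorem dense_isFreeAt (h𝔥 : IsAbelianIsometryGroup g 2 𝔥) (h𝔥S : ActsOnSpacelike g 2 𝔥) :
    Dense {x | IsFreeAt 𝔥 x} := by
  have := h𝔥.finite
  refine h𝔥S.dense.mono fun x hx ↦ isFreeAt_of_finrank_orbitTangent ?_
  rw [h𝔥.finrank_eq]
  exact hx

theorem eq_zero_of_metricProd_self_eq_zero (h𝔥S : ActsOnSpacelike g 2 𝔥) (hζ : ζ ∈ 𝔥)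
    (h : metricProd g ζ ζ x = 0) : ζ x = 0 := by
  by_contra hne
  exact (h𝔥S.spacelike x (ζ x) ⟨ζ, hζ, rfl⟩ hne).ne' h

theorem metricProd_add_right (a b c : VecField M) :
    metricProd g a (b + c) = metricProd g a b + metricProd g a c := by
  ext x; simp [metricProd]

theorem metricProd_smul_right (k : ℝ) (a b : VecField M) :
    metricProd g a (k • b) = k • metricProd g a b := by
  ext x; simp [metricProd]

theorem metricProd_add_left (a b c : VecField M) :
    metricProd g (a + b) c = metricProd g a c + metricProd g b c := by
  ext x; simp [metricProd]

theorem metricProd_smul_left (k : ℝ) (a b : VecField M) :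
    metricProd g (k • a) b = k • metricProd g a b := by
  ext x; simp [metricProd]

/-- Equality in the Cauchy-Schwarz inequality: where the Gram determinant of `ξ` and `η` vanishes,
an explicit linear combination of them vanishes too. -/
theorem smul_sub_smul_eq_zero_of_gram_eq_zero (h𝔥S : ActsOnSpacelike g 2 𝔥) (hξ : ξ ∈ 𝔥)
    (hη : η ∈ 𝔥) (hD : metricProd g ξ ξ x * metricProd g η η x
      - metricProd g ξ η x * metricProd g ξ η x = 0) :
    (metricProd g η η x • ξ + (- metricProd g ξ η x) • η) x = 0 := by
  apply eq_zero_of_metricProd_self_eq_zero h𝔥S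
    (add_mem (𝔥.smul_mem _ hξ) (𝔥.smul_mem _ hη))
  simp only [metricProd_add_right, metricProd_add_left, metricProd_smul_left,
    metricProd_smul_right, Pi.add_apply, Pi.smul_apply, smul_eq_mul, metricProd_comm (g := g) η ξ]
  linear_combination metricProd g η η x * hD

/-- The orbits are two-dimensional where the action is free; the Gram determinant of two independent
generators is the form in which this enters the analysis. -/
theorem gram_ne_zero_of_isFreeAt (h𝔥S : ActsOnSpacelike g 2 𝔥) (hξ : ξ ∈ 𝔥) (hη : η ∈ 𝔥)
    (hind : ∀ a b : ℝ, a • ξ + b • η = 0 → a = 0 ∧ b = 0) (hx : IsFreeAt 𝔥 x) :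
    metricProd g ξ ξ x * metricProd g η η x - metricProd g ξ η x * metricProd g ξ η x ≠ 0 := by
  intro hD
  have h1 := hx _ (add_mem (𝔥.smul_mem _ hξ) (𝔥.smul_mem _ hη))
    (smul_sub_smul_eq_zero_of_gram_eq_zero h𝔥S hξ hη hD)
  have h2 := hx η hη (eq_zero_of_metricProd_self_eq_zero h𝔥S hη (hind _ _ h1).1)
  exact one_ne_zero (hind 0 1 (by simp [h2])).2

end Orbits

/-! ### The axis -/

section Axis

variable {M : Type*} [TopologicalSpace M] [ChartedSpace (EuclideanSpace ℝ (Fin 4)) M]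
  [IsManifold (𝓡 4) ∞ M] {g : LorentzianMetric M} {𝔤 𝔥 : Submodule ℝ (VecField M)}
  {ξ η ζ : VecField M} {p : M} {y : EuclideanSpace ℝ (Fin 4)}

theorem chartField_eq_zero (hy : y ∈ (extChartAt (𝓡 4) p).target)
    (h : ξ ((extChartAt (𝓡 4) p).symm y) = 0) : chartField p ξ y = 0 :=
  chartField_eq_of_chartSymmDeriv hy (by rw [h, map_zero])

theorem chartMetric_nondegenerate (hy : y ∈ (extChartAt (𝓡 4) p).target)
    (u : EuclideanSpace ℝ (Fin 4)) (hu : ∀ v, chartMetric g p y u v = 0) : u = 0 := by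
  obtain ⟨b, hb⟩ := g.signature ((extChartAt (𝓡 4) p).symm y)
  apply chartSymmDeriv_injective hy
  rw [map_zero]
  apply lorentz_nondegenerate _ b hb
  intro w
  obtain ⟨v, rfl⟩ := chartSymmDeriv_surjective hy w
  exact hu v

theorem chartMetric_pos_of_orthogonal_timelike (hy : y ∈ (extChartAt (𝓡 4) p).target)
    {t w : EuclideanSpace ℝ (Fin 4)} (ht : chartMetric g p y t t < 0)
    (htw : chartMetric g p y t w = 0) (hw : w ≠ 0) : 0 < chartMetric g p y w w := by
  obtain ⟨b, hb⟩ := g.signature ((extChartAt (𝓡 4) p).symm y)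
  refine pos_of_orthogonal_timelike _ b hb ht htw fun h ↦ hw ?_
  exact chartSymmDeriv_injective hy (h.trans (map_zero _).symm)

/-- The linearization of a Killing field at a zero is skew. -/
theorem skew_fderiv_chartField (hy : y ∈ (extChartAt (𝓡 4) p).target) (hξ : IsKilling g ξ)
    (h0 : ξ ((extChartAt (𝓡 4) p).symm y) = 0) (u v : EuclideanSpace ℝ (Fin 4)) :
    chartMetric g p y (fderiv ℝ (chartField p ξ) y u) v
      + chartMetric g p y u (fderiv ℝ (chartField p ξ) y v) = 0 := by
  have h := chart_killing hy hξ u v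
  rw [chartField_eq_zero hy h0] at h
  simpa using h

/-- The linearization of a Killing field at a zero annihilates the values of the Killing fields
commuting with it. -/
theorem fderiv_chartField_apply_of_commute (hy : y ∈ (extChartAt (𝓡 4) p).target)
    (hξ : SmoothFieldAt ξ ((extChartAt (𝓡 4) p).symm y))
    (hη : SmoothFieldAt η ((extChartAt (𝓡 4) p).symm y))
    (h : VectorField.mlieBracket (𝓡 4) ξ η ((extChartAt (𝓡 4) p).symm y) = 0)
    (h0 : ξ ((extChartAt (𝓡 4) p).symm y) = 0) :
    fderiv ℝ (chartField p ξ) y (chartField p η y) = 0 := by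
  rw [← chart_commute hy hξ hη h, chartField_eq_zero hy h0, map_zero]

/-- The linearization at a zero of a nonzero generator of the group of isometries does not vanish:
otherwise the generator would vanish on an open set. -/
theorem fderiv_chartField_ne_zero (hy : y ∈ (extChartAt (𝓡 4) p).target)
    (h𝔥 : IsAbelianIsometryGroup g 2 𝔥) (h𝔥S : ActsOnSpacelike g 2 𝔥) (hξ : ξ ∈ 𝔥) (hξ0 : ξ ≠ 0)
    (h0 : ξ ((extChartAt (𝓡 4) p).symm y) = 0) : fderiv ℝ (chartField p ξ) y ≠ 0 := by
  intro h1
  have hK := h𝔥.killing ξ hξ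
  have hev := eventually_eq_zero_of_killing (isOpen_extChartAt_target (I := 𝓡 4) p)
    ((contDiffOn_chartMetric g p).of_le (by norm_cast))
    (fun z hz ↦ ((contDiffAt_chartField hz (hK.1 _)).contDiffWithinAt.of_le
      (by norm_cast)))
    (fun _ _ ↦ chartMetric_symm) (fun z hz u v ↦ chart_killing hz hK u v) hy
    (chartMetric_nondegenerate hy) (chartField_eq_zero hy h0) h1
  have hsrc := (extChartAt (𝓡 4) p).map_target hy
  have hcont : ContinuousAt (extChartAt (𝓡 4) p) ((extChartAt (𝓡 4) p).symm y) :=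
    continuousAt_extChartAt' hsrc
  rw [ContinuousAt, (extChartAt (𝓡 4) p).right_inv hy] at hcont
  have hev' := (hcont.eventually hev).and
    ((isOpen_extChartAt_source (I := 𝓡 4) p).eventually_mem hsrc)
  obtain ⟨q, hqf, hq⟩ := (dense_isFreeAt h𝔥 h𝔥S).inter_nhds_nonempty hev'
  apply hξ0
  apply hqf ξ hξ
  have := chartSymmDeriv_chartField ((extChartAt (𝓡 4) p).map_source hq.2) ξ
  rw [hq.1, map_zero, (extChartAt (𝓡 4) p).left_inv hq.2] at this
  exact this.symm

/-- The isotropy is at most one-dimensional: two independent generators of the two-parameter group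
do not vanish at the same point, because their linearizations would be independent commuting
infinitesimal rotations fixing a timelike direction. -/
theorem ne_zero_of_eq_zero (hy : y ∈ (extChartAt (𝓡 4) p).target)
    (h𝔤 : IsAbelianIsometryGroup g 3 𝔤) (h𝔤T : ActsOnTimelike g 3 𝔤) (hle : 𝔥 ≤ 𝔤)
    (h𝔥 : IsAbelianIsometryGroup g 2 𝔥) (h𝔥S : ActsOnSpacelike g 2 𝔥) (hξ : ξ ∈ 𝔥) (hη : η ∈ 𝔥)
    (hind : ∀ a b : ℝ, a • ξ + b • η = 0 → a = 0 ∧ b = 0)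
    (hξ0 : ξ ((extChartAt (𝓡 4) p).symm y) = 0) : η ((extChartAt (𝓡 4) p).symm y) ≠ 0 := by
  intro hη0
  obtain ⟨_, ⟨τ, hτ, rfl⟩, hneg⟩ := h𝔤T.timelike ((extChartAt (𝓡 4) p).symm y)
  have hK {a : VecField M} (ha : a ∈ 𝔥) : IsKilling g a := h𝔥.killing a ha
  have hsτ := (h𝔤.killing τ hτ).1 ((extChartAt (𝓡 4) p).symm y)
  have ht : chartMetric g p y (chartField p τ y) (chartField p τ y) < 0 := by
    rw [chartMetric_chartField hy]
    exact hneg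
  have hn := (isOpen_extChartAt_target (I := 𝓡 4) p).mem_nhds hy
  -- differentiating `[ξ, η] = 0` at the common zero
  have hcomm (v : EuclideanSpace ℝ (Fin 4)) :
      fderiv ℝ (chartField p ξ) y (fderiv ℝ (chartField p η) y v)
        = fderiv ℝ (chartField p η) y (fderiv ℝ (chartField p ξ) y v) := by
    have he : (fun z ↦ fderiv ℝ (chartField p η) z (chartField p ξ z))
        =ᶠ[𝓝 y] fun z ↦ fderiv ℝ (chartField p ξ) z (chartField p η z) := by
      filter_upwards [hn] with z hz
      exact chart_commute hz ((hK hξ).1 _) ((hK hη).1 _) (h𝔥.commute ξ hξ η hη _)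
    have d {a : VecField M} (ha : a ∈ 𝔥) : HasFDerivAt (chartField p a)
        (fderiv ℝ (chartField p a) y) y :=
      (differentiableAt_chartField hy ((hK ha).1 _)).hasFDerivAt
    have d' {a : VecField M} (ha : a ∈ 𝔥) : HasFDerivAt (fderiv ℝ (chartField p a))
        (fderiv ℝ (fderiv ℝ (chartField p a)) y) y :=
      (((contDiffAt_chartField hy ((hK ha).1 _)).fderiv_right (m := 1)
        (by norm_cast)).differentiableAt (by simp)).hasFDerivAt
    have e := he.fderiv_eq (𝕜 := ℝ)
    have e₁ := ((d' hη).clm_apply (d hξ)).fderiv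
    have e₂ := ((d' hξ).clm_apply (d hη)).fderiv
    rw [e₁, e₂] at e
    have := congrArg (fun T : EuclideanSpace ℝ (Fin 4) →L[ℝ] EuclideanSpace ℝ (Fin 4) ↦ T v) e
    simp only [chartField_eq_zero hy hξ0, chartField_eq_zero hy hη0] at this
    simpa using this.symm
  obtain ⟨a, b, hab, h⟩ := exists_smul_add_smul_eq_zero_of_commute_of_skew
    finrank_euclideanSpace_fin (chartMetric g p y) chartMetric_symm (chartField p τ y) ht
    (fun w h1 h2 ↦ chartMetric_pos_of_orthogonal_timelike hy ht h1 h2)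
    (fderiv ℝ (chartField p ξ) y) (fderiv ℝ (chartField p η) y)
    (skew_fderiv_chartField hy (hK hξ) hξ0) (skew_fderiv_chartField hy (hK hη) hη0)
    (fderiv_chartField_apply_of_commute hy ((hK hξ).1 _) hsτ
      (h𝔤.commute ξ (hle hξ) τ hτ _) hξ0)
    (fderiv_chartField_apply_of_commute hy ((hK hη).1 _) hsτ
      (h𝔤.commute η (hle hη) τ hτ _) hη0) hcomm
  refine fderiv_chartField_ne_zero hy h𝔥 h𝔥S (add_mem (𝔥.smul_mem a hξ) (𝔥.smul_mem b hη))
    (fun h0 ↦ ?_) ?_ ?_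
  · obtain ⟨ha, hb⟩ := hind a b h0
    rcases hab with h | h <;> contradiction
  · change a • ξ _ + b • η _ = 0
    rw [hξ0, hη0, smul_zero, smul_zero, add_zero]
  · have e : chartField p (a • ξ + b • η) = a • chartField p ξ + b • chartField p η := by
      rw [chartField, VectorField.mpullback_add, VectorField.mpullback_const_smul,
        VectorField.mpullback_const_smul]
      rfl
    rw [e, fderiv_add ((differentiableAt_chartField hy ((hK hξ).1 _)).const_smul a)
      ((differentiableAt_chartField hy ((hK hη).1 _)).const_smul b),
      fderiv_const_smul (differentiableAt_chartField hy ((hK hξ).1 _)),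
      fderiv_const_smul (differentiableAt_chartField hy ((hK hη).1 _)), h]

/-- Near a point of the axis, the points with degenerate orbits lie in the zero set of a submersion
onto a space of dimension at least two: the component of the vanishing generator `ξ` orthogonal to
the other generator `η`, projected onto the range of the linearization of `ξ`. -/
theorem exists_isOpen_preconnected_gram_ne_zero (hy : y ∈ (extChartAt (𝓡 4) p).target)
    (h𝔥 : IsAbelianIsometryGroup g 2 𝔥) (h𝔥S : ActsOnSpacelike g 2 𝔥) (hξ : ξ ∈ 𝔥) (hη : η ∈ 𝔥)
    (hξne : ξ ≠ 0) (hξ0 : ξ ((extChartAt (𝓡 4) p).symm y) = 0)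
    (hη0 : η ((extChartAt (𝓡 4) p).symm y) ≠ 0) :
    ∃ S ⊆ (extChartAt (𝓡 4) p).target, IsOpen S ∧ y ∈ S ∧ ∃ T ⊆ S, IsOpen T ∧ IsPreconnected T ∧
      S ⊆ closure T ∧ ∀ z ∈ T, metricProd g ξ ξ ((extChartAt (𝓡 4) p).symm z)
        * metricProd g η η ((extChartAt (𝓡 4) p).symm z)
        - metricProd g ξ η ((extChartAt (𝓡 4) p).symm z)
        * metricProd g ξ η ((extChartAt (𝓡 4) p).symm z) ≠ 0 := by
  have hKξ := h𝔥.killing ξ hξ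
  have hKη := h𝔥.killing η hη
  have hX0 := chartField_eq_zero hy hξ0
  set X := chartField p ξ with hX
  set Y := chartField p η with hY
  set G := chartMetric g p with hG
  set L := fderiv ℝ X y with hL
  set l : EuclideanSpace ℝ (Fin 4) → ℝ := fun z ↦ G z (X z) (Y z) with hl
  set m : EuclideanSpace ℝ (Fin 4) → ℝ := fun z ↦ G z (Y z) (Y z) with hm
  have cX (z) (hz : z ∈ (extChartAt (𝓡 4) p).target) : ContDiffAt ℝ 1 X z :=
    (contDiffAt_chartField hz (hKξ.1 _)).of_le (by norm_cast)
  have cY (z) (hz : z ∈ (extChartAt (𝓡 4) p).target) : ContDiffAt ℝ 1 Y z :=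
    (contDiffAt_chartField hz (hKη.1 _)).of_le (by norm_cast)
  have cG (z) (hz : z ∈ (extChartAt (𝓡 4) p).target) : ContDiffAt ℝ 1 G z :=
    ((contDiffOn_chartMetric g p).contDiffAt
      ((isOpen_extChartAt_target p).mem_nhds hz)).of_le (by norm_cast)
  have cl (z) (hz : z ∈ (extChartAt (𝓡 4) p).target) : ContDiffAt ℝ 1 l z :=
    ((cG z hz).clm_apply (cX z hz)).clm_apply (cY z hz)
  have cm (z) (hz : z ∈ (extChartAt (𝓡 4) p).target) : ContDiffAt ℝ 1 m z :=
    ((cG z hz).clm_apply (cY z hz)).clm_apply (cY z hz)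
  have hmy : m y ≠ 0 := fun h ↦ hη0
    (eq_zero_of_metricProd_self_eq_zero h𝔥S hη ((chartMetric_chartField hy η η).symm.trans h))
  -- the component of `ξ` orthogonal to `η`
  set Φ : EuclideanSpace ℝ (Fin 4) → EuclideanSpace ℝ (Fin 4) :=
    fun z ↦ X z - (l z * (m z)⁻¹) • Y z with hΦ
  have cΦ (z) (hz : z ∈ (extChartAt (𝓡 4) p).target) (hmz : m z ≠ 0) : ContDiffAt ℝ 1 Φ z :=
    (cX z hz).sub (((cl z hz).mul ((cm z hz).inv hmz)).smul (cY z hz))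
  have hly : l y = 0 := by simp [hl, hX0]
  -- the range of the linearization is orthogonal to `η`
  have hdl : HasFDerivAt l (0 : EuclideanSpace ℝ (Fin 4) →L[ℝ] ℝ) y := by
    have h := (((cG y hy).differentiableAt (by simp)).hasFDerivAt.clm_apply
      ((cX y hy).differentiableAt (by simp)).hasFDerivAt).clm_apply
      ((cY y hy).differentiableAt (by simp)).hasFDerivAt
    refine h.congr_fderiv ?_
    ext1 u
    have h1 := skew_fderiv_chartField hy hKξ hξ0 u (Y y)
    rw [fderiv_chartField_apply_of_commute hy (hKξ.1 _) (hKη.1 _) (h𝔥.commute ξ hξ η hη _) hξ0,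
      map_zero, add_zero] at h1
    simp only [hX0]
    simpa using h1
  have hΦy : Φ y = 0 := by simp [hΦ, hX0, hly]
  have hdΦ : fderiv ℝ Φ y = L := by
    have d := ((cX y hy).differentiableAt (by simp)).hasFDerivAt.sub
      ((hdl.mul (((cm y hy).inv hmy).differentiableAt (by simp)).hasFDerivAt).smul
        ((cY y hy).differentiableAt (by simp)).hasFDerivAt)
    refine d.fderiv.trans ?_
    ext1 u
    simp [hly, hL]
  -- a projection onto the range of `L`, which makes a submersion of `Φ`
  obtain ⟨P, hP⟩ := LinearMap.exists_leftInverse_of_injective L.range.subtype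
    (Submodule.ker_subtype _)
  have hPL (w : L.range) : P w = w := LinearMap.congr_fun hP w
  set P' : EuclideanSpace ℝ (Fin 4) →L[ℝ] L.range := LinearMap.toContinuousLinearMap P with hP'
  have hstrict : HasStrictFDerivAt (fun z ↦ P' (Φ z)) (P'.comp L) y := by
    have h := (cΦ y hy hmy).hasStrictFDerivAt (by simp)
    rw [hdΦ] at h
    exact P'.hasStrictFDerivAt.comp y h
  have hsurj : (P'.comp L).range = ⊤ := by
    rw [LinearMap.range_eq_top]
    rintro ⟨_, u, rfl⟩
    exact ⟨u, hPL ⟨L u, u, rfl⟩⟩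
  have hmcont : ContinuousOn m (extChartAt (𝓡 4) p).target := fun z hz ↦
    (cm z hz).continuousAt.continuousWithinAt
  have hopen : IsOpen ((extChartAt (𝓡 4) p).target ∩ m ⁻¹' {0}ᶜ) :=
    hmcont.isOpen_inter_preimage (isOpen_extChartAt_target p) isOpen_compl_singleton
  obtain ⟨S, hS, hSo, hyS, hconn, hcl⟩ := exists_isOpen_preconnected_ne_zero hstrict hsurj
    (by simp [hΦy]) (one_lt_finrank_range_of_skew (G y) chartMetric_symm
      (chartMetric_nondegenerate hy) L (skew_fderiv_chartField hy hKξ hξ0)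
      (fderiv_chartField_ne_zero hy h𝔥 h𝔥S hξ hξne hξ0)) (hopen.mem_nhds ⟨hy, hmy⟩)
  -- degenerate orbits lie where `Φ = 0`, by equality in the Cauchy-Schwarz inequality
  refine ⟨S, hS.trans inter_subset_left, hSo, hyS, _, inter_subset_left, ?_, hconn, hcl, ?_⟩
  · have hcont : ContinuousOn (fun z ↦ P' (Φ z)) S := fun z hz ↦
      (P'.continuous.continuousAt.comp
        (cΦ z (hS hz).1 (hS hz).2).continuousAt).continuousWithinAt
    exact hcont.isOpen_inter_preimage hSo isOpen_compl_singleton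
  · rintro z ⟨hzS, hz⟩ hD
    have hzt := (hS hzS).1
    have hmz : m z ≠ 0 := (hS hzS).2
    apply hz
    have h0 := smul_sub_smul_eq_zero_of_gram_eq_zero h𝔥S hξ hη hD
    have hXz : m z • X z - l z • Y z = 0 := by
      apply chartSymmDeriv_injective hzt
      rw [map_sub, map_smul, map_smul, map_zero, chartSymmDeriv_chartField hzt,
        chartSymmDeriv_chartField hzt, sub_eq_add_neg, ← neg_smul]
      simp only [hm, hl, hG, hX, hY, chartMetric_chartField hzt]
      exact h0
    have : Φ z = (m z)⁻¹ • (m z • X z - l z • Y z) := by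
      rw [hΦ]
      simp only [smul_sub, smul_smul, inv_mul_cancel₀ hmz, one_smul]
      rw [mul_comm]
    rw [this, hXz, smul_zero, map_zero]

end Axis

/-! ### The Killing field orthogonal to the two-parameter orbits -/

section Orthogonal

variable {M : Type*} [TopologicalSpace M] [ChartedSpace (EuclideanSpace ℝ (Fin 4)) M]
  [IsManifold (𝓡 4) ∞ M] {g : LorentzianMetric M} {𝔤 𝔥 : Submodule ℝ (VecField M)}
  {ξ η σ : VecField M} {p : M} {y : EuclideanSpace ℝ (Fin 4)}

/-- On connected sets of points with nondegenerate orbits, the direction of the orbits of the large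
group orthogonal to those of the small one is given by a fixed Killing field. -/
theorem exists_orthogonal_on_preconnected (h𝔤 : IsAbelianIsometryGroup g 3 𝔤) (hle : 𝔥 ≤ 𝔤)
    (hort : ActsOrthogonallyTransitively g 𝔥) (hξ : ξ ∈ 𝔥) (hη : η ∈ 𝔥) (hσ : σ ∈ 𝔤)
    {T : Set (EuclideanSpace ℝ (Fin 4))} (hT : T ⊆ (extChartAt (𝓡 4) p).target) (hTo : IsOpen T)
    (hTc : IsPreconnected T) (hD : ∀ z ∈ T, metricProd g ξ ξ ((extChartAt (𝓡 4) p).symm z)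
        * metricProd g η η ((extChartAt (𝓡 4) p).symm z)
        - metricProd g ξ η ((extChartAt (𝓡 4) p).symm z)
        * metricProd g ξ η ((extChartAt (𝓡 4) p).symm z) ≠ 0) :
    ∃ a b : ℝ, ∀ z ∈ T,
      metricProd g ξ (σ + (a • ξ + b • η)) ((extChartAt (𝓡 4) p).symm z) = 0 ∧
      metricProd g η (σ + (a • ξ + b • η)) ((extChartAt (𝓡 4) p).symm z) = 0 := by
  have hsm {a : VecField M} (ha : a ∈ 𝔤) (x : M) : SmoothFieldAt a x := (h𝔤.killing a ha).1 x
  have hdiff {a b : VecField M} (ha : a ∈ 𝔤) (hb : b ∈ 𝔤) {z} (hz : z ∈ T) :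
      DifferentiableAt ℝ (fun z ↦ metricProd g a b ((extChartAt (𝓡 4) p).symm z)) z :=
    (((contMDiffAt_metricProd (g := g) (hsm ha _) (hsm hb _)).comp z
      (contMDiffAt_chart_symm (hT hz))).contDiffAt).differentiableAt (by simp)
  have hexp (c : VecField M) (a b : ℝ) : metricProd g c (σ + (a • ξ + b • η))
      = fun x ↦ metricProd g c σ x + a * metricProd g c ξ x + b * metricProd g c η x := by
    ext x
    simp only [metricProd_add_right, metricProd_smul_right, Pi.add_apply, Pi.smul_apply,
      smul_eq_mul]
    ring
  have hξ' := hle hξ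
  have hη' := hle hη
  obtain ⟨a, b, h⟩ := exists_const_of_fderiv_relation
    (f₁ := fun z ↦ metricProd g ξ σ ((extChartAt (𝓡 4) p).symm z))
    (f₂ := fun z ↦ metricProd g η σ ((extChartAt (𝓡 4) p).symm z))
    (l₁₁ := fun z ↦ metricProd g ξ ξ ((extChartAt (𝓡 4) p).symm z))
    (l₁₂ := fun z ↦ metricProd g ξ η ((extChartAt (𝓡 4) p).symm z))
    (l₂₂ := fun z ↦ metricProd g η η ((extChartAt (𝓡 4) p).symm z)) hTo hTc
    (fun z hz ↦ (hdiff hξ' hσ hz).differentiableWithinAt)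
    (fun z hz ↦ (hdiff hη' hσ hz).differentiableWithinAt)
    (fun z hz ↦ (hdiff hξ' hξ' hz).differentiableWithinAt)
    (fun z hz ↦ (hdiff hξ' hη' hz).differentiableWithinAt)
    (fun z hz ↦ (hdiff hη' hη' hz).differentiableWithinAt) hD (by
      intro z hz a b h1 h2 v
      have hs : σ + (a • ξ + b • η) ∈ 𝔤 :=
        add_mem hσ (add_mem (𝔤.smul_mem a hξ') (𝔤.smul_mem b hη'))
      obtain ⟨d1, d2⟩ := dirDeriv_metricProd_eq_zero_of_orthogonal h𝔤 hle hort hξ hη hs (hD z hz)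
        (by rw [hexp]; exact h1)
        (by rw [hexp, metricProd_comm η ξ]; exact h2) (chartSymmDeriv p z v)
      rw [← fderiv_comp_chart_symm (hT hz) (mdifferentiableAt_metricProd (hsm hξ' _) (hsm hs _)),
        hexp] at d1
      rw [← fderiv_comp_chart_symm (hT hz) (mdifferentiableAt_metricProd (hsm hη' _) (hsm hs _)),
        hexp, metricProd_comm η ξ] at d2
      have e1 := (((hdiff hξ' hσ hz).hasFDerivAt.add
        ((hdiff hξ' hξ' hz).hasFDerivAt.const_mul a)).add
        ((hdiff hξ' hη' hz).hasFDerivAt.const_mul b)).fderiv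
      have e2 := (((hdiff hη' hσ hz).hasFDerivAt.add
        ((hdiff hξ' hη' hz).hasFDerivAt.const_mul a)).add
        ((hdiff hη' hη' hz).hasFDerivAt.const_mul b)).fderiv
      exact ⟨(congrArg (fun F : EuclideanSpace ℝ (Fin 4) →L[ℝ] ℝ ↦ F v) e1).symm.trans d1,
        (congrArg (fun F : EuclideanSpace ℝ (Fin 4) →L[ℝ] ℝ ↦ F v) e2).symm.trans d2⟩)
  refine ⟨a, b, fun z hz ↦ ?_⟩
  rw [hexp, hexp, metricProd_comm η ξ]
  exact h z hz

/-- Every point, on the axis or not, has a neighbourhood on which a fixed Killing field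
`s ∈ σ + 𝔥` is orthogonal to the orbits of the two-parameter group. -/
theorem exists_eventually_orthogonal_chart (h𝔤 : IsAbelianIsometryGroup g 3 𝔤)
    (h𝔤T : ActsOnTimelike g 3 𝔤) (hle : 𝔥 ≤ 𝔤) (h𝔥 : IsAbelianIsometryGroup g 2 𝔥)
    (h𝔥S : ActsOnSpacelike g 2 𝔥) (hort : ActsOrthogonallyTransitively g 𝔥) (hσ : σ ∈ 𝔤)
    (hy : y ∈ (extChartAt (𝓡 4) p).target) :
    ∃ s ∈ 𝔤, s - σ ∈ 𝔥 ∧ ∀ᶠ z in 𝓝 y, ∀ ζ ∈ 𝔥,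
      metricProd g ζ s ((extChartAt (𝓡 4) p).symm z) = 0 := by
  have hsm {a : VecField M} (ha : a ∈ 𝔤) (x : M) : SmoothFieldAt a x := (h𝔤.killing a ha).1 x
  have hcont {a b : VecField M} (ha : a ∈ 𝔤) (hb : b ∈ 𝔤) :
      ContinuousOn (fun z ↦ metricProd g a b ((extChartAt (𝓡 4) p).symm z))
        (extChartAt (𝓡 4) p).target := fun z hz ↦
    (((contMDiffAt_metricProd (g := g) (hsm ha _) (hsm hb _)).comp z
      (contMDiffAt_chart_symm hz)).contDiffAt).continuousAt.continuousWithinAt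
  -- it suffices to find a connected open set of nondegenerate orbits, dense near the point
  suffices h : ∃ ξ ∈ 𝔥, ∃ η ∈ 𝔥, (∀ ζ ∈ 𝔥, ∃ a b : ℝ, ζ = a • ξ + b • η) ∧
      ∃ S ⊆ (extChartAt (𝓡 4) p).target, IsOpen S ∧ y ∈ S ∧ ∃ T ⊆ S, IsOpen T ∧
        IsPreconnected T ∧ S ⊆ closure T ∧ ∀ z ∈ T,
        metricProd g ξ ξ ((extChartAt (𝓡 4) p).symm z)
          * metricProd g η η ((extChartAt (𝓡 4) p).symm z)
        - metricProd g ξ η ((extChartAt (𝓡 4) p).symm z)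
          * metricProd g ξ η ((extChartAt (𝓡 4) p).symm z) ≠ 0 by
    obtain ⟨ξ, hξ, η, hη, hspan, S, hS, hSo, hyS, T, hTS, hTo, hTc, hcl, hD⟩ := h
    obtain ⟨a, b, hab⟩ := exists_orthogonal_on_preconnected h𝔤 hle hort hξ hη hσ
      (hTS.trans hS) hTo hTc hD
    have hmem : a • ξ + b • η ∈ 𝔥 := add_mem (𝔥.smul_mem a hξ) (𝔥.smul_mem b hη)
    have hs : σ + (a • ξ + b • η) ∈ 𝔤 := add_mem hσ (hle hmem)
    refine ⟨_, hs, by simpa using hmem, ?_⟩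
    have hzero {c : VecField M} (hc : c ∈ 𝔤)
        (h : ∀ z ∈ T, metricProd g c (σ + (a • ξ + b • η)) ((extChartAt (𝓡 4) p).symm z) = 0)
        (z) (hz : z ∈ S) :
        metricProd g c (σ + (a • ξ + b • η)) ((extChartAt (𝓡 4) p).symm z) = 0 := by
      have hc' := ((hcont hc hs).continuousAt
        ((isOpen_extChartAt_target p).mem_nhds (hS hz)))
      have := mem_closure_image hc' (hcl hz)
      have hsub : (fun z ↦ metricProd g c (σ + (a • ξ + b • η)) ((extChartAt (𝓡 4) p).symm z)) '' T
          ⊆ {0} := by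
        rintro _ ⟨w, hw, rfl⟩
        exact h w hw
      simpa using closure_mono hsub this
    filter_upwards [hSo.mem_nhds hyS] with z hz ζ hζ
    obtain ⟨c, d, rfl⟩ := hspan ζ hζ
    rw [metricProd_add_left, metricProd_smul_left, metricProd_smul_left]
    simp only [Pi.add_apply, Pi.smul_apply]
    rw [hzero (hle hξ) (fun z hz ↦ (hab z hz).1) z hz,
      hzero (hle hη) (fun z hz ↦ (hab z hz).2) z hz]
    simp
  by_cases hfree : IsFreeAt 𝔥 ((extChartAt (𝓡 4) p).symm y)
  · have := h𝔥.finite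
    have hne : 𝔥 ≠ ⊥ := by
      rintro rfl
      simpa using h𝔥.finrank_eq
    obtain ⟨ξ, hξ, hξ0⟩ := Submodule.exists_mem_ne_zero_of_ne_bot hne
    obtain ⟨η, hη, hind, hspan⟩ := exists_pair_of_finrank_eq_two h𝔥.finrank_eq hξ hξ0
    refine ⟨ξ, hξ, η, hη, hspan, ?_⟩
    have hD := gram_ne_zero_of_isFreeAt h𝔥S hξ hη hind hfree
    have hξ' := hle hξ
    have hη' := hle hη
    have hc := ((hcont hξ' hξ').mul (hcont hη' hη')).sub ((hcont hξ' hη').mul (hcont hξ' hη'))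
    have ho := hc.isOpen_inter_preimage (isOpen_extChartAt_target p)
      (isOpen_compl_singleton (x := (0 : ℝ)))
    obtain ⟨r, hr, hball⟩ := Metric.isOpen_iff.mp ho y ⟨hy, hD⟩
    exact ⟨_, hball.trans inter_subset_left, Metric.isOpen_ball, Metric.mem_ball_self hr, _,
      subset_rfl, Metric.isOpen_ball, (convex_ball y r).isPreconnected, subset_closure,
      fun z hz ↦ (hball hz).2⟩
  · simp only [IsFreeAt, not_forall] at hfree
    obtain ⟨ξ, hξ, hξx, hξ0⟩ := hfree
    obtain ⟨η, hη, hind, hspan⟩ := exists_pair_of_finrank_eq_two h𝔥.finrank_eq hξ hξ0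
    exact ⟨ξ, hξ, η, hη, hspan, exists_isOpen_preconnected_gram_ne_zero hy h𝔥 h𝔥S hξ hη hξ0 hξx
      (ne_zero_of_eq_zero hy h𝔤 h𝔤T hle h𝔥 h𝔥S hξ hη hind hξx)⟩

theorem exists_eventually_orthogonal (h𝔤 : IsAbelianIsometryGroup g 3 𝔤)
    (h𝔤T : ActsOnTimelike g 3 𝔤) (hle : 𝔥 ≤ 𝔤) (h𝔥 : IsAbelianIsometryGroup g 2 𝔥)
    (h𝔥S : ActsOnSpacelike g 2 𝔥) (hort : ActsOrthogonallyTransitively g 𝔥) (hσ : σ ∈ 𝔤) (x : M) :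
    ∃ s ∈ 𝔤, s - σ ∈ 𝔥 ∧ ∀ᶠ q in 𝓝 x, ∀ ζ ∈ 𝔥, metricProd g ζ s q = 0 := by
  obtain ⟨s, hs, hsσ, h⟩ := exists_eventually_orthogonal_chart h𝔤 h𝔤T hle h𝔥 h𝔥S hort hσ
    (mem_extChartAt_target (I := 𝓡 4) x)
  refine ⟨s, hs, hsσ, ?_⟩
  filter_upwards [(continuousAt_extChartAt (I := 𝓡 4) x).eventually h,
    (isOpen_extChartAt_source (I := 𝓡 4) x).eventually_mem (mem_extChartAt_source x)] with q hq hqs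
  rwa [(extChartAt (𝓡 4) x).left_inv hqs] at hq

/-- The local choices of `s` agree, since `s` is determined by its direction at any point where
the group acts freely, and such points are dense. -/
theorem exists_orthogonal [ConnectedSpace M] (h𝔤 : IsAbelianIsometryGroup g 3 𝔤)
    (h𝔤T : ActsOnTimelike g 3 𝔤) (hle : 𝔥 ≤ 𝔤) (h𝔥 : IsAbelianIsometryGroup g 2 𝔥)
    (h𝔥S : ActsOnSpacelike g 2 𝔥) (hort : ActsOrthogonallyTransitively g 𝔥) (hσ : σ ∈ 𝔤) :
    ∃ s ∈ 𝔤, s - σ ∈ 𝔥 ∧ ∀ x, ∀ ζ ∈ 𝔥, metricProd g ζ s x = 0 := by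
  have hloc := exists_eventually_orthogonal h𝔤 h𝔤T hle h𝔥 h𝔥S hort hσ
  obtain ⟨x₀⟩ := (inferInstance : Nonempty M)
  obtain ⟨s, hs, hsσ, hx₀⟩ := hloc x₀
  set Q : Set M := {x | ∀ᶠ q in 𝓝 x, ∀ ζ ∈ 𝔥, metricProd g ζ s q = 0} with hQ
  have hQo : IsOpen Q := isOpen_setOfPred_eventually_nhds
  -- near a limit point `x` of `Q`, the local choice `t` coincides with `s` at a free point
  have hQc : IsClosed Q := by
    rw [← isOpen_compl_iff, isOpen_iff_mem_nhds]
    intro x hx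
    obtain ⟨t, ht, htσ, hxt⟩ := hloc x
    filter_upwards [hxt.eventually_nhds] with q hqt hqs
    obtain ⟨u, huf, hu⟩ := (dense_isFreeAt h𝔥 h𝔥S).inter_nhds_nonempty (hqt.and hqs)
    have hmem : s - t ∈ 𝔥 := by simpa using sub_mem hsσ htσ
    have h0 : metricProd g (s - t) (s - t) u = 0 := by
      have h1 := hu.1 _ hmem
      have h2 := hu.2 _ hmem
      have : metricProd g (s - t) (s - t) u
          = metricProd g (s - t) s u - metricProd g (s - t) t u :=
        map_sub (g.val u ((s - t) u)) (s u) (t u)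
      rw [this, h1, h2, sub_zero]
    have hst : s = t := sub_eq_zero.mp
      (huf _ hmem (eq_zero_of_metricProd_self_eq_zero h𝔥S hmem h0))
    rw [← hst] at hxt
    exact hx hxt
  have huniv := IsClopen.eq_univ ⟨hQc, hQo⟩ ⟨x₀, hx₀⟩
  refine ⟨s, hs, hsσ, fun x ↦ ?_⟩
  have hx : x ∈ Q := huniv ▸ mem_univ x
  exact hx.self_of_nhds

/-- The orbit through any point contains a timelike vector `τ = c s + ζ` with `ζ` tangent to the
spacelike orbit and orthogonal to `s`, so that `g(s, s)` must be negative. -/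
theorem isTimelike_of_orthogonal (h𝔤 : IsAbelianIsometryGroup g 3 𝔤)
    (h𝔤T : ActsOnTimelike g 3 𝔤) (hle : 𝔥 ≤ 𝔤) (h𝔥 : IsAbelianIsometryGroup g 2 𝔥)
    (h𝔥S : ActsOnSpacelike g 2 𝔥) {s : VecField M} (hs : s ∈ 𝔤) (hs' : s ∉ 𝔥)
    (horth : ∀ x, ∀ ζ ∈ 𝔥, metricProd g ζ s x = 0) : IsTimelike g s := by
  intro x
  have := h𝔤.finite
  obtain ⟨_, ⟨τ, hτ, rfl⟩, hneg⟩ := h𝔤T.timelike x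
  obtain ⟨c, hc⟩ := exists_sub_smul_mem hle (by rw [h𝔤.finrank_eq, h𝔥.finrank_eq]) hs hs' hτ
  set ζ := τ - c • s with hζ
  have hτe : τ = c • s + ζ := by rw [hζ]; abel
  have h1 : metricProd g τ τ x = c * (c * metricProd g s s x) + metricProd g ζ ζ x := by
    rw [hτe]
    simp only [metricProd_add_right, metricProd_add_left, metricProd_smul_left,
      metricProd_smul_right, Pi.add_apply, Pi.smul_apply, smul_eq_mul, metricProd_comm (g := g) s ζ,
      horth x ζ hc]
    ring
  have h2 : metricProd g τ τ x < 0 := hneg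
  have h3 : 0 ≤ metricProd g ζ ζ x := by
    by_cases h0 : ζ x = 0
    · simp [metricProd, h0]
    · exact (h𝔥S.spacelike x (ζ x) ⟨ζ, hc, rfl⟩ h0).le
  change metricProd g s s x < 0
  by_contra hcon
  nlinarith [mul_nonneg (mul_self_nonneg c) (not_lt.mp hcon)]

/-- A Killing field of the group which is orthogonal to the orbits of the two-parameter group is
hypersurface-orthogonal: `ds` is annihilated by the generators of the two-parameter group, hence so
is `s ∧ ds`, which must then vanish where the group acts freely, and everywhere by continuity. -/
theorem isIntegrable_of_orthogonal (h𝔤 : IsAbelianIsometryGroup g 3 𝔤) (hle : 𝔥 ≤ 𝔤)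
    (h𝔥 : IsAbelianIsometryGroup g 2 𝔥) (h𝔥S : ActsOnSpacelike g 2 𝔥) {s : VecField M}
    (hs : s ∈ 𝔤) (horth : ∀ x, ∀ ζ ∈ 𝔥, metricProd g ζ s x = 0) : IsIntegrable g s := by
  have hsm {a : VecField M} (ha : a ∈ 𝔤) (x : M) : SmoothFieldAt a x := (h𝔤.killing a ha).1 x
  have key (p : M) (y : EuclideanSpace ℝ (Fin 4)) (hy : y ∈ (extChartAt (𝓡 4) p).target)
      (X : Fin 3 → VecField M) (hX : ∀ i, SmoothFieldAt (X i) ((extChartAt (𝓡 4) p).symm y)) :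
      wedgeExtDeriv (flat g s) (flat g s) X ((extChartAt (𝓡 4) p).symm y) = 0 := by
    set β := chartFlat g p s with hβ
    set θ : EuclideanSpace ℝ (Fin 4) → EuclideanSpace ℝ (Fin 4) → EuclideanSpace ℝ (Fin 4) → ℝ :=
      fun z u v ↦ fderiv ℝ β z u v - fderiv ℝ β z v u with hθ
    have hflat (i : Fin 3) : flat g s ((extChartAt (𝓡 4) p).symm y)
        (X i ((extChartAt (𝓡 4) p).symm y)) = β y (chartField p (X i) y) :=
      (chartMetric_chartField hy s (X i)).symm
    rw [wedgeExtDeriv_eq, extDerivOneForm_flat hy (hsm hs _) (hX 1) (hX 2),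
      extDerivOneForm_flat hy (hsm hs _) (hX 2) (hX 0),
      extDerivOneForm_flat hy (hsm hs _) (hX 0) (hX 1), hflat, hflat, hflat]
    generalize chartField p (X 0) y = u
    generalize chartField p (X 1) y = v
    generalize chartField p (X 2) y = w
    -- the three-form vanishes at the points where the group acts freely
    have hfree (z) (hz : z ∈ (extChartAt (𝓡 4) p).target)
        (hf : IsFreeAt 𝔥 ((extChartAt (𝓡 4) p).symm z)) :
        β z u * θ z v w + β z v * θ z w u + β z w * θ z u v = 0 := by
      have := h𝔥.finite
      have hne : 𝔥 ≠ ⊥ := by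
        rintro rfl
        simpa using h𝔥.finrank_eq
      obtain ⟨ξ, hξ, hξ0⟩ := Submodule.exists_mem_ne_zero_of_ne_bot hne
      obtain ⟨η, hη, hind, -⟩ := exists_pair_of_finrank_eq_two h𝔥.finrank_eq hξ hξ0
      have hsrc := (extChartAt (𝓡 4) p).map_target hz
      have hβ0 {ζ : VecField M} (hζ : ζ ∈ 𝔥) : β z (chartField p ζ z) = 0 := by
        have := chartMetric_chartField (g := g) hz s ζ
        rw [metricProd_comm, horth _ ζ hζ] at this
        exact this
      have hθ0 {ζ : VecField M} (hζ : ζ ∈ 𝔥) (v : EuclideanSpace ℝ (Fin 4)) :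
          θ z (chartField p ζ z) v = 0 := by
        have hv := smoothFieldAt_coordField hsrc v
        have h1 := extDerivOneForm_flat (g := g) hz (hsm hs _) (hsm (hle hζ) _) hv
        rw [extDerivOneForm_flat_killing (h𝔤.killing ζ (hle hζ)) (hsm hs _) hv
          (h𝔤.commute ζ (hle hζ) s hs _), chartField_coordField hz] at h1
        have h2 : metricProd g s ζ = fun _ ↦ 0 := by
          rw [metricProd_comm]
          exact funext fun x ↦ horth x ζ hζ
        rw [h2] at h1
        simp only [hθ]
        rw [← h1, dirDeriv, mfderiv_const]
        exact neg_zero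
      have hli : LinearIndependent ℝ ![chartField p ξ z, chartField p η z] := by
        rw [LinearIndependent.pair_iff]
        intro a b hab
        apply hind
        apply hf _ (add_mem (𝔥.smul_mem a hξ) (𝔥.smul_mem b hη))
        have := congrArg (chartSymmDeriv p z) hab
        rw [map_add, map_smul, map_smul, map_zero, chartSymmDeriv_chartField hz,
          chartSymmDeriv_chartField hz] at this
        exact this
      refine wedge_eq_zero_of_two_kernel_vectors finrank_euclideanSpace_fin (β z) (θ z) ?_ ?_ ?_ hli
        (hβ0 hξ) (hβ0 hη) (hθ0 hξ) (hθ0 hη) u v w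
      · intro u v w
        simp only [hθ, map_add, FunLike.coe_add, Pi.add_apply]
        ring
      · intro c u w
        simp only [hθ, map_smul, FunLike.coe_smul, Pi.smul_apply, smul_eq_mul]
        ring
      · intro u v
        simp only [hθ]
        ring
    have hcβ : ContDiffAt ℝ 1 β y := (contDiffAt_chartFlat hy (hsm hs _)).of_le (by norm_cast)
    have hcβ' : ContinuousAt (fderiv ℝ β) y :=
      (hcβ.fderiv_right (m := 0) (by norm_num)).continuousAt
    have hc1 (u : EuclideanSpace ℝ (Fin 4)) : ContinuousAt (fun z ↦ β z u) y :=
      hcβ.continuousAt.clm_apply continuousAt_const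
    have hc2 (u v : EuclideanSpace ℝ (Fin 4)) : ContinuousAt (fun z ↦ θ z u v) y :=
      ((hcβ'.clm_apply continuousAt_const).clm_apply continuousAt_const).sub
        ((hcβ'.clm_apply continuousAt_const).clm_apply continuousAt_const)
    have hc : ContinuousAt (fun z ↦ β z u * θ z v w + β z v * θ z w u + β z w * θ z u v) y :=
      (((hc1 u).mul (hc2 v w)).add ((hc1 v).mul (hc2 w u))).add ((hc1 w).mul (hc2 u v))
    by_contra hne
    have hev := (hc.eventually_ne hne).and
      ((isOpen_extChartAt_target (I := 𝓡 4) p).eventually_mem hy)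
    have hsrc := (extChartAt (𝓡 4) p).map_target hy
    have hcont : ContinuousAt (extChartAt (𝓡 4) p) ((extChartAt (𝓡 4) p).symm y) :=
      continuousAt_extChartAt' hsrc
    rw [ContinuousAt, (extChartAt (𝓡 4) p).right_inv hy] at hcont
    obtain ⟨q, hqf, hq, hqs⟩ := (dense_isFreeAt h𝔥 h𝔥S).inter_nhds_nonempty
      ((hcont.eventually hev).and ((isOpen_extChartAt_source (I := 𝓡 4) p).eventually_mem hsrc))
    exact hq.1 (hfree _ hq.2 (by rwa [(extChartAt (𝓡 4) p).left_inv hqs]))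
  intro x X hX
  have := key x (extChartAt (𝓡 4) x x) (mem_extChartAt_target x) X
  rw [extChartAt_to_inv] at this
  exact this hX

end Orthogonal

end Spacetime

theorem mainTheorem3 {M : Type*} [TopologicalSpace M] [T2Space M] [SecondCountableTopology M]
    [ConnectedSpace M] [ChartedSpace (EuclideanSpace ℝ (Fin 4)) M] [IsManifold (𝓡 4) ∞ M]
    (g : Spacetime.LorentzianMetric M)
    (𝔤 𝔥 : Submodule ℝ (Spacetime.VecField M))
    (h𝔤 : Spacetime.IsAbelianIsometryGroup g 3 𝔤) (h𝔤T : Spacetime.ActsOnTimelike g 3 𝔤)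
    (hle : 𝔥 ≤ 𝔤)
    (h𝔥 : Spacetime.IsAbelianIsometryGroup g 2 𝔥) (h𝔥S : Spacetime.ActsOnSpacelike g 2 𝔥)
    (hort : Spacetime.ActsOrthogonallyTransitively g 𝔥) :
    (∃ s : Spacetime.VecField M,
      Spacetime.IsKilling g s ∧ Spacetime.IsTimelike g s ∧ Spacetime.IsIntegrable g s) ∧
    Spacetime.IsStatic g := by
  obtain ⟨σ, hσ, hσ'⟩ : ∃ σ ∈ 𝔤, σ ∉ 𝔥 := by
    by_contra! h
    have h1 := h𝔤.finrank_eq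
    rw [le_antisymm h hle, h𝔥.finrank_eq] at h1
    omega
  obtain ⟨s, hs, hsσ, horth⟩ := Spacetime.exists_orthogonal h𝔤 h𝔤T hle h𝔥 h𝔥S hort hσ
  have hs' : s ∉ 𝔥 := fun h ↦ hσ' (by simpa using sub_mem h hsσ)
  have key : Spacetime.IsStatic g := ⟨s, h𝔤.killing s hs,
    Spacetime.isTimelike_of_orthogonal h𝔤 h𝔤T hle h𝔥 h𝔥S hs hs' horth,
    Spacetime.isIntegrable_of_orthogonal h𝔤 hle h𝔥 h𝔥S hs horth⟩
  exact ⟨key, key⟩
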